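/- Let $d \ge 1$, $1\le p<\infty$, and let $\rho\in L^1(\mathbb{R}^d)$ be nonnegative. Identify $\rho$ with its precise representative $\rho:\mathbb{R}^d\to[0,\infty]$, where $\rho(x)=\lim_{h\to0}\frac{1}{|B_h(x)|}\int_{B_h(x)}\rho(\xi)\,d\xi$ if $x$ is a Lebesgue point of $\rho$ (that is, if there is a $c\in\mathbb{R}$ with $\lim_{h\to 0}\frac{1}{|B_h(x)|}\int_{B_h(x)}|\rho(\xi)-c|\,d\xi=0$), and $\rho(x)=\infty$ otherwise. For $\theta_0\in(0,1)$, $v\in\mathbb{S}^{d-1}$ and $r>0$ put $$\rho_{\theta_0}(rv)=\inf_{\theta\in[\theta_0,1]}\rho(\theta r v)\,\theta^{-p}.$$ Assume the cone condition: there exist $\theta_0\in(0,1)$, $\Lambda\subset\mathbb{S}^{d-1}$ and $v_0\in\Lambda$ such that $\mathcal{H}^{d-1}(\Lambda)>0$, $\rho_{\theta_0}(rv)=\rho_{\theta_0}(rv_0)$ for all $v\in\Lambda$ and all $r>0$, and $$\lim_{\delta\to0^+}\frac{\delta^p}{\int_0^\delta\rho_{\theta_0}(rv_0)\,r^{d-1}\,dr}=0.$$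 Let $\mathcal{S}_{\rho,p}(\mathbb{R}^d)$ be the space of all $u\in L^p(\mathbb{R}^d;\mathbb{R}^d)$ with $$|u|_{\mathcal{S}_{\rho,p}}^p=\int_{\mathbb{R}^d}\int_{\mathbb{R}^d}\rho(y-x)\left|\frac{u(y)-u(x)}{|y-x|}\cdot\frac{y-x}{|y-x|}\right|^p dy\,dx<\infty,$$ with norm $\left(\|u\|_{L^p}^p+|u|_{\mathcal{S}_{\rho,p}}^p\right)^{1/p}$. If $\{u_n\}$ is a bounded sequence in $\mathcal{S}_{\rho,p}(\mathbb{R}^d)$, then for every bounded open set $D\subset\mathbb{R}^d$ the sequence of restrictions $\{u_n|_D\}$ is precompact in $L^p(D;\mathbb{R}^d)$, that is, its closure in $L^p(D;\mathbb{R}^d)$ is compact. -/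

import Mathlib

open MeasureTheory Set Filter Topology
open scoped ENNReal NNReal

noncomputable section

namespace NonlocalSpace

variable {d : ℕ}

/-- `x` is a Lebesgue point of (the a.e.-class of) `ρ`: the mean oscillation of `ρ` about some
constant `c` over the balls `B_h(x)` tends to zero. -/
def IsLebesguePoint (ρ : EuclideanSpace ℝ (Fin d) → ℝ) (x : EuclideanSpace ℝ (Fin d)) : Prop :=
  ∃ c : ℝ, Tendsto (fun h : ℝ => ⨍ ξ in Metric.ball x h, |ρ ξ - c|) (𝓝[>] 0) (𝓝 0)

open Classical in
/-- The precise representative of `ρ`, with values in `[0, ∞]`: the limit of the averages over the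
balls `B_h(x)` at Lebesgue points (there the limit exists), and `∞` at all other points. -/
def preciseRep (ρ : EuclideanSpace ℝ (Fin d) → ℝ) (x : EuclideanSpace ℝ (Fin d)) : ℝ≥0∞ :=
  if IsLebesguePoint ρ x then
    ENNReal.ofReal (limUnder (𝓝[>] (0 : ℝ)) fun h : ℝ => ⨍ ξ in Metric.ball x h, ρ ξ)
  else ∞

/-- The lower envelope `ρ_{θ₀}(ξ) = inf_{θ ∈ [θ₀, 1]} ρ(θ ξ) θ^{-p}`, computed with the precise
representative of `ρ`. -/
def lowerEnvelope (ρ : EuclideanSpace ℝ (Fin d) → ℝ) (p θ₀ : ℝ)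
    (ξ : EuclideanSpace ℝ (Fin d)) : ℝ≥0∞ :=
  ⨅ θ ∈ Icc θ₀ 1, preciseRep ρ (θ • ξ) * ENNReal.ofReal (θ ^ (-p))

/-- The cone condition: for some `θ₀ ∈ (0, 1)`, some set `Λ` of directions of positive
`(d-1)`-dimensional Hausdorff measure and some `v₀ ∈ Λ`, the lower envelope takes the same values
along all directions of `Λ`, and `δ^p / ∫_0^δ ρ_{θ₀}(r v₀) r^{d-1} dr → 0` as `δ → 0+`. -/
def ConeCondition (ρ : EuclideanSpace ℝ (Fin d) → ℝ) (p : ℝ) : Prop :=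
  ∃ θ₀ ∈ Ioo (0 : ℝ) 1, ∃ Λ ⊆ Metric.sphere (0 : EuclideanSpace ℝ (Fin d)) 1, ∃ v₀ ∈ Λ,
    0 < Measure.hausdorffMeasure ((d : ℝ) - 1) Λ ∧
    (∀ v ∈ Λ, ∀ r : ℝ, 0 < r → lowerEnvelope ρ p θ₀ (r • v) = lowerEnvelope ρ p θ₀ (r • v₀)) ∧
    Tendsto
      (fun δ : ℝ => ENNReal.ofReal (δ ^ p) /
        ∫⁻ r in Ioo (0 : ℝ) δ, lowerEnvelope ρ p θ₀ (r • v₀) * ENNReal.ofReal (r ^ (d - 1)))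
      (𝓝[>] 0) (𝓝 0)

/-- The projected difference quotient
`(u(y) - u(x)) / |y - x| · (y - x) / |y - x|`. -/
def projDiffQuotient (u : EuclideanSpace ℝ (Fin d) → EuclideanSpace ℝ (Fin d))
    (x y : EuclideanSpace ℝ (Fin d)) : ℝ :=
  inner ℝ (‖y - x‖⁻¹ • (u y - u x)) (‖y - x‖⁻¹ • (y - x))

/-- The `p`-th power of the seminorm,
`|u|^p = ∫ ∫ ρ(y - x) |D(u)(x, y)|^p dy dx`, in `[0, ∞]`. -/
def seminormPow (ρ : EuclideanSpace ℝ (Fin d) → ℝ) (p : ℝ)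
    (u : EuclideanSpace ℝ (Fin d) → EuclideanSpace ℝ (Fin d)) : ℝ≥0∞ :=
  ∫⁻ x, ∫⁻ y, ENNReal.ofReal (ρ (y - x) * |projDiffQuotient u x y| ^ p)

/-- Membership in the nonlocal space `S_{ρ,p}(ℝ^d)`. -/
def MemS (ρ : EuclideanSpace ℝ (Fin d) → ℝ) (p : ℝ≥0∞)
    (u : EuclideanSpace ℝ (Fin d) → EuclideanSpace ℝ (Fin d)) : Prop :=
  MemLp u p volume ∧ seminormPow ρ p.toReal u < ∞

/-- The norm `(‖u‖_{L^p}^p + |u|^p)^{1/p}` of `S_{ρ,p}(ℝ^d)`, in `[0, ∞]`. -/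
def normS (ρ : EuclideanSpace ℝ (Fin d) → ℝ) (p : ℝ≥0∞)
    (u : EuclideanSpace ℝ (Fin d) → EuclideanSpace ℝ (Fin d)) : ℝ≥0∞ :=
  (eLpNorm u p volume ^ p.toReal + seminormPow ρ p.toReal u) ^ (1 / p.toReal)

end NonlocalSpace

end

/-! Let `F h` be `projIncr p u h`. By Fubini the seminorm is `∫ ρ(h) F(h) |h|^{-p} dh`, so it
controls `F` only in an average weighted by `ρ`, whereas compactness needs `F` small on a set of
displacements at a single scale `δ`.

Splitting a displacement into `k` equal steps gives `F(kh) ≤ k^p F(h)` (`projIncr_natCast_smul_le`).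
For `r < ηδ`, taking `⌊δ/r⌋` steps carries a bound from distances near `r` to distances near `δ`.
The rounding error is absorbed by averaging over dilations `θ ∈ (θ₀, 1)`, which is why the envelope
of `ρ` enters and not `ρ` itself. Integrating in `r` (`lintegral_mul_lintegral_le_of_dilation`) and
over directions (`exists_coneAnnulus_lintegral_projIncr_le`) bounds `∫_A F(δz) dz`, for a conical
annulus `A` of positive volume, by a multiple of `δ^p / ∫_0^{ηδ} ρ_{θ₀}(r v₀) r^{d-1} dr` times the
seminorm. The cone condition makes this small.

`F` sees only one component of the increment, but the projections onto the lines `ℝz`, averaged over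
`z ∈ A`, form an invertible operator (`exists_comp_integral_lineProj`). This yields a matrix kernel
on `δA` with integral the identity, for which `∫_A F(δz) dz` controls the `L^p` distance from `u` to
its convolution (`exists_kernel_approx`). The family is thus uniformly close to its convolutions
with one kernel, which may be taken continuous with compact support; an Arzelà–Ascoli argument on
`D` concludes. -/

namespace NonlocalSpace

/-! ### Polar coordinates. -/

section Polar

variable {E : Type*} [NormedAddCommGroup E] [NormedSpace ℝ E] [FiniteDimensional ℝ E]
  [MeasurableSpace E] [BorelSpace E]

/-- Integration in polar coordinates for the lower Lebesgue integral. -/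
theorem lintegral_eq_lintegral_toSphere [Nontrivial E] (μ : Measure E) [μ.IsAddHaarMeasure]
    {f : E → ℝ≥0∞} (hf : Measurable f) :
    ∫⁻ x, f x ∂μ = ∫⁻ v, (∫⁻ r in Ioi (0 : ℝ),
      f (r • (v : E)) * ENNReal.ofReal (r ^ (Module.finrank ℝ E - 1))) ∂μ.toSphere := by
  have hmeas : Measurable fun q : Metric.sphere (0 : E) 1 × Ioi (0 : ℝ) => f (q.2.1 • q.1.1) := by
    fun_prop
  calc ∫⁻ x, f x ∂μ = ∫⁻ x in ({0}ᶜ : Set E), f x ∂μ := by rw [restrict_compl_singleton]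
    _ = ∫⁻ x : ({(0)}ᶜ : Set E), f x.1 ∂(μ.comap (↑)) := by
        rw [lintegral_subtype_comap (measurableSet_singleton _).compl]
    _ = ∫⁻ q, f (q.2.1 • q.1.1) ∂μ.toSphere.prod
          (Measure.volumeIoiPow (Module.finrank ℝ E - 1)) := by
        rw [← μ.measurePreserving_homeomorphUnitSphereProd.lintegral_comp hmeas]
        refine lintegral_congr fun x => ?_
        have : ‖x.1‖ ≠ 0 := norm_ne_zero_iff.2 x.2
        simp [smul_smul, this]
    _ = ∫⁻ v, ∫⁻ r : Ioi (0 : ℝ), f (r.1 • v.1)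
          ∂(Measure.volumeIoiPow (Module.finrank ℝ E - 1)) ∂μ.toSphere := by
        rw [lintegral_prod _ hmeas.aemeasurable]
    _ = _ := by
        refine lintegral_congr fun v => ?_
        rw [Measure.volumeIoiPow, lintegral_withDensity_eq_lintegral_mul _ (by fun_prop)
          (by fun_prop), ← lintegral_subtype_comap measurableSet_Ioi]
        refine lintegral_congr fun r => ?_
        simp [mul_comm]

/-- A property valid almost everywhere holds almost everywhere along almost every ray. -/
theorem ae_toSphere_ae_of_ae [Nontrivial E] (μ : Measure E) [μ.IsAddHaarMeasure] {P : E → Prop}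
    (h : ∀ᵐ x ∂μ, P x) :
    ∀ᵐ v : Metric.sphere (0 : E) 1 ∂μ.toSphere, ∀ᵐ r ∂(volume.restrict (Ioi (0 : ℝ))), P (r • (v : E)) := by
  obtain ⟨t, ht, htm, ht0⟩ := exists_measurable_superset_of_null (ae_iff.1 h)
  have hf : Measurable (t.indicator (1 : E → ℝ≥0∞)) := measurable_one.indicator htm
  have h0 : ∫⁻ x, t.indicator (1 : E → ℝ≥0∞) x ∂μ = 0 := by
    rw [lintegral_indicator_one htm, ht0]
  rw [lintegral_eq_lintegral_toSphere μ hf, lintegral_eq_zero_iff] at h0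
  · filter_upwards [h0] with v hv
    simp only [Pi.zero_apply] at hv
    rw [lintegral_eq_zero_iff (by fun_prop)] at hv
    filter_upwards [hv, ae_restrict_mem measurableSet_Ioi] with r hr hr0
    by_contra hP
    have : r • (v : E) ∈ t := ht hP
    have h1 : 0 < r ^ (Module.finrank ℝ E - 1) := pow_pos hr0 _
    simp [this, h1.not_ge] at hr
  · refine Measurable.lintegral_prod_right' (f := fun q : Metric.sphere (0 : E) 1 × ℝ =>
      t.indicator (1 : E → ℝ≥0∞) (q.2 • (q.1 : E)) *
        ENNReal.ofReal (q.2 ^ (Module.finrank ℝ E - 1))) ?_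
    fun_prop

end Polar

/-! ### Change of scale along a ray. -/

section OneDim

theorem lintegral_comp_mul_left {c : ℝ} (hc : 0 < c) {f : ℝ → ℝ≥0∞} (hf : Measurable f) :
    ∫⁻ s, f (c * s) = ENNReal.ofReal c⁻¹ * ∫⁻ s, f s := by
  rw [← lintegral_map hf (measurable_const_mul c), Real.map_volume_mul_left hc.ne',
    lintegral_smul_measure, abs_of_pos (inv_pos.2 hc), smul_eq_mul]

/-- `k = ⌊δ/r⌋` steps of length `r` reach `δ` up to the factor `c = kr/δ`, which the substitution `s
↦ cs` absorbs. The upper end `1 - η` leaves room for this rounding. -/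
theorem lintegral_Ioo_comp_le_of_dilation {p : ℝ} (hp : 0 ≤ p) {θ₀ η : ℝ}
    (hθ₀ : 0 < θ₀) (hη : 0 < η) (hθη : θ₀ ≤ 1 - η) {f : ℝ → ℝ≥0∞} (hf : Measurable f)
    (hsub : ∀ k : ℕ, 1 ≤ k → ∀ r : ℝ, 0 < r → f (k * r) ≤ (k : ℝ≥0∞) ^ p * f r)
    {δ r : ℝ} (hr : 0 < r) (hrδ : r < η * δ) :
    ∫⁻ s in Ioo θ₀ (1 - η), f (δ * s) ≤
      ENNReal.ofReal ((δ / r) ^ p) * ∫⁻ θ in Ioo θ₀ 1, f (r * θ) := by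
  have hδ : 0 < δ := by
    by_contra h
    nlinarith
  have hη1 : η < 1 := by linarith
  set k := ⌊δ / r⌋₊ with hk
  have hk1 : 1 ≤ k := by
    rw [hk, Nat.one_le_floor_iff, one_le_div hr]
    nlinarith
  have hk0 : (0 : ℝ) < k := by exact_mod_cast hk1
  have hkle : (k : ℝ) ≤ δ / r := Nat.floor_le (by positivity)
  have hkle' : k * r ≤ δ := by rwa [le_div_iff₀ hr] at hkle
  have hklt : δ / r < k + 1 := Nat.lt_floor_add_one _
  -- Rounding down loses less than `r < ηδ`. Hence `c ∈ (1-η, 1]`, and `cs ∈ (θ₀, 1-η)` forces `s ∈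
  -- (θ₀, 1)`.
  have hklt' : (1 - η) * δ < k * r := by
    rw [div_lt_iff₀ hr] at hklt
    nlinarith
  set c := k * r / δ with hc
  have hc0 : 0 < c := by positivity
  have hc1 : c ≤ 1 := (div_le_one hδ).2 hkle'
  have hcη : 1 - η < c := by rw [hc, lt_div_iff₀ hδ]; exact hklt'
  have hcδ : δ * c = k * r := by rw [hc]; field_simp
  set φ : ℝ → ℝ≥0∞ := (Ioo θ₀ (1 - η)).indicator fun s => f (δ * s) with hφ
  have hφm : Measurable φ := Measurable.indicator (by fun_prop) measurableSet_Ioo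
  have h1 : ∫⁻ s in Ioo θ₀ (1 - η), f (δ * s) = ENNReal.ofReal c * ∫⁻ s, φ (c * s) := by
    rw [lintegral_comp_mul_left hc0 hφm, ← mul_assoc, ← ENNReal.ofReal_mul hc0.le,
      mul_inv_cancel₀ hc0.ne', ENNReal.ofReal_one, one_mul, hφ,
      lintegral_indicator measurableSet_Ioo]
  have h2 : ∀ s, φ (c * s) ≤ ENNReal.ofReal ((δ / r) ^ p) *
      (Ioo θ₀ 1).indicator (fun θ => f (r * θ)) s := by
    intro s
    by_cases hs : c * s ∈ Ioo θ₀ (1 - η)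
    · have hs0 : 0 < s := pos_of_mul_pos_right (hθ₀.trans hs.1) hc0.le
      have hs1 : s ∈ Ioo θ₀ 1 := by
        constructor
        · nlinarith [hs.1]
        · by_contra! h
          nlinarith [hs.2]
      rw [hφ, indicator_of_mem hs, indicator_of_mem hs1, ← mul_assoc, hcδ, mul_assoc]
      refine (hsub k hk1 (r * s) (by positivity)).trans ?_
      gcongr
      rw [← ENNReal.ofReal_rpow_of_nonneg (by positivity) hp, ← ENNReal.ofReal_natCast]
      gcongr
    · rw [hφ, indicator_of_notMem hs]
      exact zero_le
  calc _ = ENNReal.ofReal c * ∫⁻ s, φ (c * s) := h1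
    _ ≤ 1 * ∫⁻ s, φ (c * s) := by
        gcongr
        exact ENNReal.ofReal_le_one.2 hc1
    _ ≤ ∫⁻ s, ENNReal.ofReal ((δ / r) ^ p) * (Ioo θ₀ 1).indicator (fun θ => f (r * θ)) s := by
        rw [one_mul]
        exact lintegral_mono h2
    _ = _ := by
        rw [lintegral_const_mul _ (Measurable.indicator (by fun_prop) measurableSet_Ioo),
          lintegral_indicator measurableSet_Ioo]

/-- Along a ray: a function with `f (k r) ≤ k ^ p f r` is controlled at the scale `δ` by its
weighted integral, if the weight dominates `g` up to dilations by `θ ∈ [θ₀, 1]`. -/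
theorem lintegral_mul_lintegral_le_of_dilation {p : ℝ} {n : ℕ} (hp : 0 ≤ p) {θ₀ η : ℝ}
    (hθ₀ : 0 < θ₀) (hη : 0 < η) (hθη : θ₀ ≤ 1 - η)
    {f w w' g : ℝ → ℝ≥0∞} (hf : Measurable f) (hw : Measurable w)
    (hsub : ∀ k : ℕ, 1 ≤ k → ∀ r : ℝ, 0 < r → f (k * r) ≤ (k : ℝ≥0∞) ^ p * f r)
    (hww' : ∀ᵐ r ∂(volume.restrict (Ioi (0 : ℝ))), w' r = w r)
    (hg : ∀ r : ℝ, 0 < r → ∀ θ ∈ Icc θ₀ 1, g r ≤ w' (θ * r) * ENNReal.ofReal (θ ^ (-p)))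
    {δ : ℝ} (hδ : 0 < δ) :
    (∫⁻ r in Ioo 0 (η * δ), g r * ENNReal.ofReal (r ^ n)) *
        (∫⁻ s in Ioo θ₀ (1 - η), f (δ * s)) ≤
      ENNReal.ofReal (θ₀⁻¹ ^ (n + 1)) * ENNReal.ofReal (δ ^ p) *
        ∫⁻ s in Ioi (0 : ℝ), w s * f s * ENNReal.ofReal (s ^ (-p)) * ENNReal.ofReal (s ^ n) := by
  set φ : ℝ → ℝ≥0∞ := (Ioi (0 : ℝ)).indicator fun s =>
    w s * f s * ENNReal.ofReal (s ^ (-p)) * ENNReal.ofReal (s ^ n) with hφ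
  have hφm : Measurable φ := Measurable.indicator (by fun_prop) measurableSet_Ioi
  set H := ∫⁻ s in Ioo θ₀ (1 - η), f (δ * s) with hH
  have key : ∀ r ∈ Ioo 0 (η * δ), g r * ENNReal.ofReal (r ^ n) * H ≤
      ENNReal.ofReal (θ₀⁻¹ ^ n) * ENNReal.ofReal (δ ^ p) * ∫⁻ θ in Ioo θ₀ 1, φ (r * θ) := by
    intro r hr
    have hr0 : 0 < r := hr.1
    -- The pointwise bound is for `w'`; since dilation by a fixed `r` preserves null sets, it passes
    -- to the measurable `w` for a.e. `θ`.
    have hae : ∀ᵐ θ ∂(volume.restrict (Ioo θ₀ 1)), g r ≤ w (r * θ) * ENNReal.ofReal (θ ^ (-p)) := by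
      rw [ae_restrict_iff' measurableSet_Ioi] at hww'
      filter_upwards [ae_restrict_of_ae ((Measure.quasiMeasurePreserving_smul volume hr0.ne').ae hww'),
        ae_restrict_mem measurableSet_Ioo] with θ hθ hθm
      have hθ0 : 0 < θ := hθ₀.trans hθm.1
      rw [← smul_eq_mul r θ, ← hθ (mul_pos hr0 hθ0), smul_eq_mul, mul_comm r θ]
      exact hg r hr0 θ ⟨hθm.1.le, hθm.2.le⟩
    calc g r * ENNReal.ofReal (r ^ n) * H
        ≤ g r * ENNReal.ofReal (r ^ n) *
          (ENNReal.ofReal ((δ / r) ^ p) * ∫⁻ θ in Ioo θ₀ 1, f (r * θ)) := by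
          gcongr
          exact lintegral_Ioo_comp_le_of_dilation hp hθ₀ hη hθη hf hsub hr0 hr.2
      _ = ∫⁻ θ in Ioo θ₀ 1,
            g r * ENNReal.ofReal (r ^ n) * (ENNReal.ofReal ((δ / r) ^ p) * f (r * θ)) := by
          rw [← lintegral_const_mul _ (by fun_prop), ← lintegral_const_mul _ (by fun_prop)]
      _ ≤ ∫⁻ θ in Ioo θ₀ 1, ENNReal.ofReal (θ₀⁻¹ ^ n) * ENNReal.ofReal (δ ^ p) * φ (r * θ) := by
          refine lintegral_mono_ae ?_
          filter_upwards [hae, ae_restrict_mem measurableSet_Ioo] with θ hθ hθm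
          have hθ0 : 0 < θ := hθ₀.trans hθm.1
          have hrθ : 0 < r * θ := mul_pos hr0 hθ0
          rw [hφ, indicator_of_mem (show r * θ ∈ Ioi (0 : ℝ) from hrθ)]
          calc _ ≤ w (r * θ) * ENNReal.ofReal (θ ^ (-p)) * ENNReal.ofReal (r ^ n) *
                (ENNReal.ofReal ((δ / r) ^ p) * f (r * θ)) := by gcongr
            _ = w (r * θ) * f (r * θ) *
                ENNReal.ofReal (θ ^ (-p) * r ^ n * (δ / r) ^ p) := by
                rw [ENNReal.ofReal_mul (by positivity), ENNReal.ofReal_mul (by positivity)]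
                ring
            _ ≤ w (r * θ) * f (r * θ) *
                ENNReal.ofReal (θ₀⁻¹ ^ n * δ ^ p * ((r * θ) ^ (-p) * (r * θ) ^ n)) := by
                -- The factor `θ^{-p}` of the envelope turns `r^{-p}` into `(rθ)^{-p}` exactly; only
                -- `r^n ≤ θ₀^{-n} (rθ)^n` is lossy.
                gcongr _ * ENNReal.ofReal ?_
                rw [Real.div_rpow hδ.le hr0.le, Real.mul_rpow hr0.le hθ0.le,
                  Real.rpow_neg hr0.le p, mul_pow, div_eq_mul_inv]
                have h1 : 1 ≤ θ₀⁻¹ ^ n * θ ^ n := by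
                  rw [← mul_pow]
                  refine one_le_pow₀ ?_
                  rw [inv_mul_eq_div, one_le_div hθ₀]
                  exact hθm.1.le
                have h2 : 0 ≤ θ ^ (-p) * r ^ n * (δ ^ p * (r ^ p)⁻¹) := by positivity
                calc _ ≤ θ ^ (-p) * r ^ n * (δ ^ p * (r ^ p)⁻¹) * (θ₀⁻¹ ^ n * θ ^ n) :=
                      le_mul_of_one_le_right h2 h1
                  _ = _ := by ring
            _ = _ := by
                rw [ENNReal.ofReal_mul (by positivity), ENNReal.ofReal_mul (by positivity),
                  ENNReal.ofReal_mul (by positivity)]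
                ring
      _ = _ := by rw [lintegral_const_mul _ (by fun_prop)]
  -- The Jacobian costs one more `θ₀⁻¹`, whence the exponent `n + 1`.
  have hdil : ∀ θ ∈ Ioo θ₀ 1, ∫⁻ r, φ (r * θ) ≤ ENNReal.ofReal θ₀⁻¹ * ∫⁻ r, φ r := by
    intro θ hθ
    simp_rw [mul_comm _ θ]
    rw [lintegral_comp_mul_left (hθ₀.trans hθ.1) hφm]
    gcongr
    exact hθ.1.le
  -- `g` will be an uncountable infimum and is not assumed measurable; moving `H` inside uses the
  -- inequality that needs no measurability.
  calc (∫⁻ r in Ioo 0 (η * δ), g r * ENNReal.ofReal (r ^ n)) * H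
      ≤ ∫⁻ r in Ioo 0 (η * δ), g r * ENNReal.ofReal (r ^ n) * H := lintegral_mul_const_le _ _
    _ ≤ ∫⁻ r in Ioo 0 (η * δ), ENNReal.ofReal (θ₀⁻¹ ^ n) * ENNReal.ofReal (δ ^ p) *
          ∫⁻ θ in Ioo θ₀ 1, φ (r * θ) := setLIntegral_mono' measurableSet_Ioo key
    _ ≤ ∫⁻ r, ENNReal.ofReal (θ₀⁻¹ ^ n) * ENNReal.ofReal (δ ^ p) *
          ∫⁻ θ in Ioo θ₀ 1, φ (r * θ) := setLIntegral_le_lintegral _ _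
    _ = ENNReal.ofReal (θ₀⁻¹ ^ n) * ENNReal.ofReal (δ ^ p) *
          ∫⁻ θ in Ioo θ₀ 1, ∫⁻ r, φ (r * θ) := by
        have hm : Measurable fun q : ℝ × ℝ => φ (q.1 * q.2) := by fun_prop
        rw [lintegral_const_mul _ hm.lintegral_prod_right', lintegral_lintegral_swap hm.aemeasurable]
    _ ≤ ENNReal.ofReal (θ₀⁻¹ ^ n) * ENNReal.ofReal (δ ^ p) *
          ∫⁻ θ in Ioo θ₀ 1, ENNReal.ofReal θ₀⁻¹ * ∫⁻ r, φ r := by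
        gcongr 1
        exact setLIntegral_mono' measurableSet_Ioo hdil
    _ ≤ ENNReal.ofReal (θ₀⁻¹ ^ n) * ENNReal.ofReal (δ ^ p) *
          (ENNReal.ofReal θ₀⁻¹ * ∫⁻ r, φ r) := by
        gcongr 1
        rw [setLIntegral_const, Real.volume_Ioo]
        refine mul_le_of_le_one_right' (ENNReal.ofReal_le_one.2 (by linarith))
    _ = _ := by
        rw [hφ, lintegral_indicator measurableSet_Ioi, pow_succ,
          ENNReal.ofReal_mul (by positivity)]
        ring

end OneDim

/-! ### Directional increments. -/

section Increments

variable {E : Type*} [NormedAddCommGroup E] [InnerProductSpace ℝ E] [MeasureSpace E]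

/-- The `p`-th power of the `L^p` norm of the increment of `u` by `h`, projected onto the
direction of `h`. -/
noncomputable def projIncr (p : ℝ) (u : E → E) (h : E) : ℝ≥0∞ :=
  ∫⁻ x, ‖inner ℝ (u (x + h) - u x) (‖h‖⁻¹ • h)‖ₑ ^ p

variable [FiniteDimensional ℝ E] [BorelSpace E] [(volume : Measure E).IsAddHaarMeasure]

theorem measurable_projIncr (p : ℝ) {u : E → E} (hu : Measurable u) :
    Measurable (projIncr p u) := by
  refine Measurable.lintegral_prod_right' (f := fun q : E × E =>
    ‖inner ℝ (u (q.2 + q.1) - u q.2) (‖q.1‖⁻¹ • q.1)‖ₑ ^ p) ?_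
  fun_prop

/-- The increment telescopes into `k` increments by `h` in the same direction. Convexity costs
`k^{p-1}`, and by translation invariance the `k` terms have equal integrals. -/
theorem projIncr_natCast_smul_le {p : ℝ} (hp : 1 ≤ p) {u : E → E} (hu : Measurable u) {k : ℕ}
    (hk : 1 ≤ k) (h : E) :
    projIncr p u ((k : ℝ) • h) ≤ (k : ℝ≥0∞) ^ p * projIncr p u h := by
  have hk0 : (0 : ℝ) < k := by exact_mod_cast hk
  set e := ‖h‖⁻¹ • h with he
  have hdir : ‖(k : ℝ) • h‖⁻¹ • (k : ℝ) • h = e := by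
    rw [he, norm_smul, Real.norm_of_nonneg hk0.le, smul_smul]
    congr 1
    field_simp
  let a : ℕ → E → ℝ≥0∞ := fun j x => ‖inner ℝ (u (x + (j : ℝ) • h + h) - u (x + (j : ℝ) • h)) e‖ₑ
  have ha : ∀ j, Measurable (a j) := fun j => by fun_prop
  have hpt : ∀ x, ‖inner ℝ (u (x + (k : ℝ) • h) - u x) e‖ₑ ^ p ≤
      (k : ℝ≥0∞) ^ (p - 1) * ∑ j ∈ Finset.range k, a j x ^ p := by
    intro x
    have h1 : u (x + (k : ℝ) • h) - u x =
        ∑ j ∈ Finset.range k, (u (x + (j : ℝ) • h + h) - u (x + (j : ℝ) • h)) := by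
      have := Finset.sum_range_sub (fun j : ℕ => u (x + (j : ℝ) • h)) k
      simp only [Nat.cast_zero, zero_smul, add_zero] at this
      rw [← this]
      refine Finset.sum_congr rfl fun j _ => ?_
      rw [Nat.cast_add, Nat.cast_one, add_smul, one_smul, add_assoc]
    have h2 : ‖inner ℝ (u (x + (k : ℝ) • h) - u x) e‖ₑ ≤ ∑ j ∈ Finset.range k, a j x := by
      rw [h1, sum_inner]
      exact enorm_sum_le _ _
    calc _ ≤ (∑ j ∈ Finset.range k, a j x) ^ p := by gcongr
      _ ≤ _ := by
        have := ENNReal.rpow_sum_le_const_mul_sum_rpow (Finset.range k) (fun j => a j x) hp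
        simpa using this
  calc projIncr p u ((k : ℝ) • h) = ∫⁻ x, ‖inner ℝ (u (x + (k : ℝ) • h) - u x) e‖ₑ ^ p := by
        rw [projIncr, hdir]
    _ ≤ ∫⁻ x, (k : ℝ≥0∞) ^ (p - 1) * ∑ j ∈ Finset.range k, a j x ^ p := lintegral_mono hpt
    _ = (k : ℝ≥0∞) ^ (p - 1) * ∑ j ∈ Finset.range k, ∫⁻ x, a j x ^ p := by
        rw [lintegral_const_mul _ (by fun_prop), lintegral_finsetSum _ (by fun_prop)]
    _ = (k : ℝ≥0∞) ^ (p - 1) * ∑ j ∈ Finset.range k, projIncr p u h := by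
        congr 1
        refine Finset.sum_congr rfl fun j _ => ?_
        exact lintegral_add_right_eq_self
          (fun x => ‖inner ℝ (u (x + h) - u x) e‖ₑ ^ p) ((j : ℝ) • h)
    _ = (k : ℝ≥0∞) ^ p * projIncr p u h := by
        have h0 : (k : ℝ≥0∞) ≠ 0 := by exact_mod_cast (by omega : k ≠ 0)
        rw [Finset.sum_const, Finset.card_range, nsmul_eq_mul, ← mul_assoc,
          ENNReal.rpow_sub _ _ h0 (ENNReal.natCast_ne_top k), ENNReal.rpow_one,
          ENNReal.div_mul_cancel h0 (ENNReal.natCast_ne_top k)]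

end Increments

/-! ### Null sets of the sphere: surface measure against Hausdorff measure. -/

section SphereNull

theorem norm_normalize_sub_normalize_le {E : Type*} [NormedAddCommGroup E] [NormedSpace ℝ E]
    {x y : E} (hx : 1 ≤ ‖x‖) (hy : 1 ≤ ‖y‖) : ‖‖x‖⁻¹ • x - ‖y‖⁻¹ • y‖ ≤ 2 * ‖x - y‖ := by
  have hx0 : 0 < ‖x‖ := by linarith
  have hy0 : 0 < ‖y‖ := by linarith
  have h : ‖x‖⁻¹ • x - ‖y‖⁻¹ • y = ‖x‖⁻¹ • (x - y) + (‖x‖⁻¹ - ‖y‖⁻¹) • y := by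
    rw [smul_sub, sub_smul]; abel
  have h1 : ‖x‖⁻¹ ≤ 1 := inv_le_one_of_one_le₀ hx
  calc _ ≤ ‖‖x‖⁻¹ • (x - y)‖ + ‖(‖x‖⁻¹ - ‖y‖⁻¹) • y‖ := by rw [h]; exact norm_add_le _ _
    _ = ‖x‖⁻¹ * ‖x - y‖ + ‖x‖⁻¹ * |‖x‖ - ‖y‖| := by
        rw [norm_smul, norm_smul, Real.norm_of_nonneg (by positivity), Real.norm_eq_abs]
        congr 1
        rw [inv_sub_inv hx0.ne' hy0.ne', abs_div, abs_of_pos (mul_pos hx0 hy0), abs_sub_comm]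
        field_simp
    _ ≤ 1 * ‖x - y‖ + 1 * ‖x - y‖ := by
        gcongr
        exact abs_norm_sub_norm_le x y
    _ = _ := by ring

/-- The chart of the unit sphere given by central projection onto the hyperplane `x i = s`. -/
noncomputable def sphereChart {n : ℕ} (i : Fin (n + 1)) (s : ℝ) (w : Fin n → ℝ) :
    EuclideanSpace ℝ (Fin (n + 1)) :=
  ‖WithLp.toLp 2 (i.insertNth s w : Fin (n + 1) → ℝ)‖⁻¹ •
    WithLp.toLp 2 (i.insertNth s w : Fin (n + 1) → ℝ)

/-- Before normalisation the `i`-th coordinate is `±1`, so the point stays at distance at least `1`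
from the origin, where normalising is Lipschitz. -/
theorem lipschitzWith_sphereChart {n : ℕ} (i : Fin (n + 1)) {s : ℝ} (hs : |s| = 1) :
    ∃ K, LipschitzWith K (sphereChart i s) := by
  obtain ⟨K, hK⟩ : ∃ K, LipschitzWith K
      (fun x : Fin (n + 1) → ℝ => (WithLp.toLp 2 x : EuclideanSpace ℝ (Fin (n + 1)))) :=
    ⟨_, PiLp.lipschitzWith_toLp 2 _⟩
  have hn : ∀ w : Fin n → ℝ,
      1 ≤ ‖(WithLp.toLp 2 (i.insertNth s w : Fin (n + 1) → ℝ) : EuclideanSpace ℝ (Fin (n + 1)))‖ := by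
    intro w
    have := PiLp.norm_apply_le (WithLp.toLp 2 (i.insertNth s w : Fin (n + 1) → ℝ) :
      EuclideanSpace ℝ (Fin (n + 1))) i
    simpa [hs] using this
  refine ⟨2 * K, LipschitzWith.of_dist_le_mul fun w w' => ?_⟩
  rw [sphereChart, sphereChart, dist_eq_norm]
  refine (norm_normalize_sub_normalize_le (hn w) (hn w')).trans ?_
  rw [← dist_eq_norm, NNReal.coe_mul, NNReal.coe_ofNat, mul_assoc]
  gcongr
  refine (hK.dist_le_mul _ _).trans ?_
  gcongr
  simp

theorem exists_sphereChart_eq {n : ℕ} {v : EuclideanSpace ℝ (Fin (n + 1))} (hv : ‖v‖ = 1) :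
    ∃ i, ∃ s ∈ ({1, -1} : Set ℝ), ∃ w, sphereChart i s w = v := by
  obtain ⟨i, hi⟩ : ∃ i, v i ≠ 0 := by
    by_contra! h
    have : v = 0 := by ext i; simp [h i]
    simp [this] at hv
  have hi' : 0 < |v i| := abs_pos.2 hi
  -- Dividing by `|v i|` and not by `v i` preserves the direction of `v`; hence the two heights `s =
  -- ±1`.
  refine ⟨i, |v i|⁻¹ * v i, ?_, fun j => |v i|⁻¹ * v (i.succAbove j), ?_⟩
  · rcases abs_cases (v i) with ⟨h, _⟩ | ⟨h, _⟩
    · left; rw [h]; field_simp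
    · right; rw [h, mem_singleton_iff]; field_simp
  · have h : (WithLp.toLp 2 (i.insertNth (|v i|⁻¹ * v i)
        (fun j => |v i|⁻¹ * v (i.succAbove j)) : Fin (n + 1) → ℝ) :
        EuclideanSpace ℝ (Fin (n + 1))) = |v i|⁻¹ • v := by
      ext j
      induction j using i.succAboveCases <;> simp
    rw [sphereChart, h, norm_smul, hv, norm_inv, Real.norm_eq_abs, abs_abs, mul_one, inv_inv,
      smul_smul, mul_inv_cancel₀ hi'.ne', one_smul]

/-- The hyperplane `x i = s` is null, so Fubini says nothing about it alone. It does give the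
property on almost every hyperplane `x i = st`; one such `t > 0` suffices, because only the
direction of `x` matters. -/
theorem ae_sphereChart_of_ae {n : ℕ} {P : EuclideanSpace ℝ (Fin (n + 1)) → Prop}
    (h : ∀ᵐ x : EuclideanSpace ℝ (Fin (n + 1)), P (‖x‖⁻¹ • x)) (i : Fin (n + 1)) {s : ℝ}
    (hs : s ≠ 0) : ∀ᵐ w, P (sphereChart i s w) := by
  have hmp : MeasurePreserving
      (fun q : ℝ × (Fin n → ℝ) =>
        (WithLp.toLp 2 (i.insertNth q.1 q.2 : Fin (n + 1) → ℝ) : EuclideanSpace ℝ (Fin (n + 1))))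
      volume volume :=
    (PiLp.volume_preserving_toLp (Fin (n + 1))).comp
      (volume_preserving_piFinSuccAbove (fun _ => ℝ) i).symm
  have h1 := Measure.ae_ae_of_ae_prod (hmp.quasiMeasurePreserving.ae h)
  have h2 := (Measure.quasiMeasurePreserving_smul (volume : Measure ℝ) hs).ae h1
  have h3 := ae_restrict_of_ae (s := Ioi (0 : ℝ)) h2
  have : (ae (volume.restrict (Ioi (0 : ℝ)))).NeBot := by
    rw [ae_neBot]
    simp
  obtain ⟨t, ht, ht0⟩ := (h3.and (ae_restrict_mem measurableSet_Ioi)).exists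
  have ht0 : 0 < t := ht0
  filter_upwards [(Measure.quasiMeasurePreserving_smul (volume : Measure (Fin n → ℝ)) ht0.ne').ae ht]
    with w hw
  have hsc : (WithLp.toLp 2 (i.insertNth (s • t) (t • w) : Fin (n + 1) → ℝ) :
      EuclideanSpace ℝ (Fin (n + 1))) =
      t • WithLp.toLp 2 (i.insertNth s w : Fin (n + 1) → ℝ) := by
    ext j
    induction j using i.succAboveCases <;> simp [mul_comm]
  rw [hsc, norm_smul, smul_smul, Real.norm_of_nonneg ht0.le, mul_inv, mul_right_comm,
    inv_mul_cancel₀ ht0.ne', one_mul] at hw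
  exact hw

/-- A subset of the unit sphere of `ℝ^(n+1)` that is null for the surface measure
`volume.toSphere` is null for the `n`-dimensional Hausdorff measure. -/
theorem hausdorffMeasure_image_eq_zero_of_toSphere {n : ℕ}
    {N : Set (Metric.sphere (0 : EuclideanSpace ℝ (Fin (n + 1))) 1)}
    (hN : (volume : Measure (EuclideanSpace ℝ (Fin (n + 1)))).toSphere N = 0) :
    Measure.hausdorffMeasure (n : ℝ) (Subtype.val '' N) = 0 := by
  obtain ⟨t, ht, htm, ht0⟩ := exists_measurable_superset_of_null hN
  have htm' : MeasurableSet (Subtype.val '' t) :=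
    (MeasurableEmbedding.subtype_coe Metric.isClosed_sphere.measurableSet).measurableSet_image.2 htm
  -- By polar coordinates, the cone over a null set of directions is Lebesgue null.
  have hae : ∀ᵐ x : EuclideanSpace ℝ (Fin (n + 1)), ‖x‖⁻¹ • x ∉ Subtype.val '' t := by
    have hset : MeasurableSet {x : EuclideanSpace ℝ (Fin (n + 1)) | ‖x‖⁻¹ • x ∈ Subtype.val '' t} :=
      (by fun_prop : Measurable fun x : EuclideanSpace ℝ (Fin (n + 1)) => ‖x‖⁻¹ • x) htm'
    rw [ae_iff]
    simp only [not_not]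
    rw [← lintegral_indicator_one hset, lintegral_eq_lintegral_toSphere volume
      (measurable_one.indicator hset), lintegral_eq_zero_of_ae_eq_zero]
    filter_upwards [measure_eq_zero_iff_ae_notMem.1 ht0] with v hv
    refine (setLIntegral_congr_fun measurableSet_Ioi fun r hr => ?_).trans lintegral_zero
    have hr : 0 < r := hr
    have : r • (v : EuclideanSpace ℝ (Fin (n + 1))) ∉
        {x : EuclideanSpace ℝ (Fin (n + 1)) | ‖x‖⁻¹ • x ∈ Subtype.val '' t} := by
      rw [mem_ofPred_eq, norm_smul, norm_eq_of_mem_sphere, Real.norm_of_nonneg hr.le, mul_one,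
        smul_smul, inv_mul_cancel₀ hr.ne', one_smul]
      simpa using hv
    beta_reduce
    rw [indicator_of_notMem this, zero_mul]
  have hsub : Subtype.val '' N ⊆ ⋃ i, ⋃ s ∈ ({1, -1} : Set ℝ),
      sphereChart i s '' {w | sphereChart i s w ∈ Subtype.val '' t} := by
    rintro _ ⟨v, hv, rfl⟩
    obtain ⟨i, s, hs, w, hw⟩ := exists_sphereChart_eq (norm_eq_of_mem_sphere v)
    simp only [mem_iUnion]
    exact ⟨i, s, hs, w, by rw [mem_ofPred_eq, hw]; exact mem_image_of_mem _ (ht hv), hw⟩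
  refine measure_mono_null hsub (measure_iUnion_null fun i => ?_)
  rw [measure_biUnion_null_iff (by simp)]
  intro s hs
  have hs1 : |s| = 1 := by
    rcases hs with rfl | rfl <;> simp
  have hs0 : s ≠ 0 := by
    rintro rfl
    simp at hs1
  obtain ⟨K, hK⟩ := lipschitzWith_sphereChart i hs1
  refine le_antisymm ((hK.hausdorffMeasure_image_le (Nat.cast_nonneg n) _).trans ?_) zero_le
  have h0 : Measure.hausdorffMeasure (n : ℝ)
      {w : Fin n → ℝ | sphereChart i s w ∈ Subtype.val '' t} = 0 := by
    -- With the sup metric on `Fin n → ℝ` the measure `H^n` is exactly Lebesgue measure; the charts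
    -- are defined there for this reason.
    have h1 := hausdorffMeasure_pi_real (ι := Fin n)
    rw [Fintype.card_fin] at h1
    rw [h1, measure_eq_zero_iff_ae_notMem]
    exact ae_sphereChart_of_ae (P := fun x => x ∉ Subtype.val '' t) hae i hs0
  rw [h0, mul_zero]

end SphereNull

/-! ### The precise representative. -/

section PreciseRep

/-- Lebesgue differentiation over closed balls; spheres are null, so open balls give the same
averages. -/
theorem preciseRep_ae_eq {d : ℕ} {ρ : EuclideanSpace ℝ (Fin d) → ℝ} (hρ : Integrable ρ volume) :
    preciseRep ρ =ᵐ[volume] fun x => ENNReal.ofReal (ρ x) := by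
  have hball : ∀ (x : EuclideanSpace ℝ (Fin d)) (f : EuclideanSpace ℝ (Fin d) → ℝ),
      ∀ᶠ h in 𝓝[>] (0 : ℝ), ⨍ ξ in Metric.closedBall x h, f ξ = ⨍ ξ in Metric.ball x h, f ξ := by
    intro x f
    filter_upwards [self_mem_nhdsWithin] with h hh
    refine setAverage_congr ?_
    have hh : 0 < h := hh
    have := Measure.addHaar_sphere_of_ne_zero (volume : Measure (EuclideanSpace ℝ (Fin d))) x hh.ne'
    rw [← Metric.ball_union_sphere]
    exact union_ae_eq_left_of_ae_eq_empty (ae_eq_empty.2 this)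
  filter_upwards [IsUnifLocDoublingMeasure.ae_tendsto_average_norm_sub volume hρ.locallyIntegrable 1,
    IsUnifLocDoublingMeasure.ae_tendsto_average volume hρ.locallyIntegrable 1] with x h1 h2
  have hmem : ∀ᶠ h in 𝓝[>] (0 : ℝ), x ∈ Metric.closedBall x (1 * h) := by
    filter_upwards [self_mem_nhdsWithin] with h hh
    have hh : 0 < h := hh
    simp [hh.le]
  have h1' := h1 (fun _ => x) (fun h : ℝ => h) (l := 𝓝[>] (0 : ℝ)) tendsto_id hmem
  have h2' := h2 (fun _ => x) (fun h : ℝ => h) (l := 𝓝[>] (0 : ℝ)) tendsto_id hmem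
  rw [preciseRep, if_pos, ((tendsto_congr' (hball x ρ)).1 h2').limUnder_eq]
  exact ⟨ρ x, (tendsto_congr' (hball x _)).1 h1'⟩

end PreciseRep

/-! ### From rays to conical annuli. -/

section Cone

variable {E : Type*} [NormedAddCommGroup E] [InnerProductSpace ℝ E]

/-- The part of the cone over `T` that lies in the annulus `a < ‖z‖ < b`. -/
def coneAnnulus (T : Set (Metric.sphere (0 : E) 1)) (a b : ℝ) : Set E :=
  {z | ‖z‖ ∈ Ioo a b ∧ ‖z‖⁻¹ • z ∈ Subtype.val '' T}

theorem smul_mem_coneAnnulus {T : Set (Metric.sphere (0 : E) 1)} {a b r : ℝ} (hr : 0 < r)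
    (v : Metric.sphere (0 : E) 1) : r • (v : E) ∈ coneAnnulus T a b ↔ r ∈ Ioo a b ∧ v ∈ T := by
  have h1 : ‖r • (v : E)‖ = r := by
    rw [norm_smul, norm_eq_of_mem_sphere, mul_one, Real.norm_of_nonneg hr.le]
  rw [coneAnnulus, mem_ofPred_eq, h1, smul_smul, inv_mul_cancel₀ hr.ne', one_smul]
  simp

variable [MeasureSpace E]

theorem measurableSet_coneAnnulus [BorelSpace E] {T : Set (Metric.sphere (0 : E) 1)}
    (hT : MeasurableSet T) (a b : ℝ) : MeasurableSet (coneAnnulus T a b) := by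
  have hT' : MeasurableSet (Subtype.val '' T) :=
    (MeasurableEmbedding.subtype_coe Metric.isClosed_sphere.measurableSet).measurableSet_image.2 hT
  exact (measurable_norm measurableSet_Ioo).inter
    ((by fun_prop : Measurable fun z : E => ‖z‖⁻¹ • z) hT')

variable [FiniteDimensional ℝ E] [BorelSpace E] [(volume : Measure E).IsAddHaarMeasure]

theorem setLIntegral_coneAnnulus [Nontrivial E] {T : Set (Metric.sphere (0 : E) 1)}
    (hT : MeasurableSet T) {a : ℝ} (ha : 0 ≤ a) (b : ℝ) {f : E → ℝ≥0∞} (hf : Measurable f) :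
    ∫⁻ z in coneAnnulus T a b, f z = ∫⁻ v in T, (∫⁻ r in Ioo a b,
      f (r • (v : E)) * ENNReal.ofReal (r ^ (Module.finrank ℝ E - 1)))
        ∂(volume : Measure E).toSphere := by
  have hA := measurableSet_coneAnnulus hT a b
  rw [← lintegral_indicator hA, lintegral_eq_lintegral_toSphere volume (hf.indicator hA),
    ← lintegral_indicator hT]
  refine lintegral_congr fun v => ?_
  by_cases hv : v ∈ T
  · rw [indicator_of_mem hv, ← lintegral_indicator measurableSet_Ioo,
      ← lintegral_indicator measurableSet_Ioi]
    refine lintegral_congr fun r => ?_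
    by_cases hr : 0 < r
    · rw [indicator_of_mem (show r ∈ Ioi (0 : ℝ) from hr)]
      by_cases hr' : r ∈ Ioo a b
      · rw [indicator_of_mem hr', indicator_of_mem ((smul_mem_coneAnnulus hr v).2 ⟨hr', hv⟩)]
      · rw [indicator_of_notMem hr', indicator_of_notMem
          fun h => hr' ((smul_mem_coneAnnulus hr v).1 h).1, zero_mul]
    · rw [indicator_of_notMem (show r ∉ Ioi (0 : ℝ) from hr),
        indicator_of_notMem fun h => hr (ha.trans_lt h.1)]
  · rw [indicator_of_notMem hv]
    refine (setLIntegral_congr_fun measurableSet_Ioi fun r hr => ?_).trans lintegral_zero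
    rw [indicator_of_notMem fun h => hv ((smul_mem_coneAnnulus hr v).1 h).2, zero_mul]

theorem volume_coneAnnulus_pos [Nontrivial E] {T : Set (Metric.sphere (0 : E) 1)}
    (hT : MeasurableSet T) (hT0 : (volume : Measure E).toSphere T ≠ 0) {a b : ℝ} (ha : 0 ≤ a)
    (hab : a < b) : volume (coneAnnulus T a b) ≠ 0 := by
  rw [← setLIntegral_one, setLIntegral_coneAnnulus hT ha b measurable_const, setLIntegral_const]
  refine mul_ne_zero ?_ hT0
  rw [Ne, lintegral_eq_zero_iff (by fun_prop)]
  intro h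
  have : (ae (volume.restrict (Ioo a b))).NeBot := by
    rw [ae_neBot]
    simpa using hab
  obtain ⟨r, hr, hr0⟩ := (h.and (ae_restrict_mem measurableSet_Ioo)).exists
  have h1 : 0 < r ^ (Module.finrank ℝ E - 1) := pow_pos (ha.trans_lt hr0.1) _
  simp [h1.not_ge] at hr

/-- If the weight `w` dominates the radial function `g`, up to dilations by `θ ∈ [θ₀, 1]`, in all
directions of a set `Λ`, then the directional increments of `u` over a conical annulus at the
scale `δ` are controlled by the seminorm with weight `w`. -/
theorem exists_coneAnnulus_lintegral_projIncr_le [Nontrivial E] {p : ℝ} (hp : 1 ≤ p) {θ₀ η : ℝ}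
    (hθ₀ : 0 < θ₀) (hη : 0 < η) (hθη : θ₀ ≤ 1 - η) {w w' : E → ℝ≥0∞} {g : ℝ → ℝ≥0∞}
    (hw : Measurable w) (hww' : w' =ᵐ[volume] w) {Λ : Set (Metric.sphere (0 : E) 1)}
    (hΛ : (volume : Measure E).toSphere Λ ≠ 0)
    (hg : ∀ v ∈ Λ, ∀ r : ℝ, 0 < r → ∀ θ ∈ Icc θ₀ 1,
      g r ≤ w' (θ • r • (v : E)) * ENNReal.ofReal (θ ^ (-p))) :
    ∃ T : Set (Metric.sphere (0 : E) 1), MeasurableSet T ∧ (volume : Measure E).toSphere T ≠ 0 ∧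
      ∀ u : E → E, Measurable u → ∀ δ : ℝ, 0 < δ →
        (∫⁻ r in Ioo 0 (η * δ), g r * ENNReal.ofReal (r ^ (Module.finrank ℝ E - 1))) *
            ∫⁻ z in coneAnnulus T θ₀ (1 - η), projIncr p u (δ • z) ≤
          ENNReal.ofReal (θ₀⁻¹ ^ (Module.finrank ℝ E - 1 + 1)) * ENNReal.ofReal (δ ^ p) *
            ∫⁻ h, w h * projIncr p u h * ENNReal.ofReal (‖h‖ ^ (-p)) := by
  set n := Module.finrank ℝ E - 1 with hn
  set σ := (volume : Measure E).toSphere with hσ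
  -- `Λ` need not be measurable. `Λ'` keeps the directions of `Λ` along which `w' = w` a.e., which
  -- is almost all of them, and `T` is its measurable hull.
  set Λ' : Set (Metric.sphere (0 : E) 1) := {v | v ∈ Λ ∧
    ∀ᵐ r ∂(volume.restrict (Ioi (0 : ℝ))), w' (r • (v : E)) = w (r • (v : E))} with hΛ'
  have hΛΛ' : σ Λ' = σ Λ := by
    refine measure_congr (Filter.eventuallyEq_set.2 ?_)
    filter_upwards [ae_toSphere_ae_of_ae volume hww'] with v hv
    exact ⟨fun h => h.1, fun h => ⟨h, hv⟩⟩
  refine ⟨toMeasurable σ Λ', measurableSet_toMeasurable _ _, by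
    rwa [measure_toMeasurable, hΛΛ'], fun u hu δ hδ => ?_⟩
  have hF := measurable_projIncr p hu
  set C := ENNReal.ofReal (θ₀⁻¹ ^ (n + 1)) * ENNReal.ofReal (δ ^ p) with hC
  have hCtop : C ≠ ∞ := ENNReal.mul_ne_top ENNReal.ofReal_ne_top ENNReal.ofReal_ne_top
  set m := ∫⁻ r in Ioo 0 (η * δ), g r * ENNReal.ofReal (r ^ n) with hm
  set H : Metric.sphere (0 : E) 1 → ℝ≥0∞ := fun v =>
    ∫⁻ s in Ioo θ₀ (1 - η), projIncr p u ((δ * s) • (v : E)) with hH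
  set J : Metric.sphere (0 : E) 1 → ℝ≥0∞ := fun v =>
    ∫⁻ s in Ioi (0 : ℝ), w (s • (v : E)) * projIncr p u (s • (v : E)) *
      ENNReal.ofReal (s ^ (-p)) * ENNReal.ofReal (s ^ n) with hJ
  have hHm : Measurable H := by
    refine Measurable.lintegral_prod_right' (f := fun q : Metric.sphere (0 : E) 1 × ℝ =>
      projIncr p u ((δ * q.2) • (q.1 : E))) ?_
    fun_prop
  have hJm : Measurable J := by
    refine Measurable.lintegral_prod_right' (f := fun q : Metric.sphere (0 : E) 1 × ℝ =>
      w (q.2 • (q.1 : E)) * projIncr p u (q.2 • (q.1 : E)) *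
      ENNReal.ofReal (q.2 ^ (-p)) * ENNReal.ofReal (q.2 ^ n)) ?_
    fun_prop
  have hray : ∀ v ∈ Λ', m * H v ≤ C * J v := by
    intro v hv
    refine lintegral_mul_lintegral_le_of_dilation (n := n) (p := p)
      (f := fun s => projIncr p u (s • (v : E))) (w := fun s => w (s • (v : E)))
      (w' := fun s => w' (s • (v : E))) (by linarith) hθ₀ hη hθη (by fun_prop) (by fun_prop)
      ?_ hv.2 ?_ hδ
    · intro k hk r _
      rw [mul_smul]
      exact projIncr_natCast_smul_le hp hu hk _
    · intro r hr θ hθ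
      rw [mul_smul]
      exact hg v hv.1 r hr θ hθ
  have hMm : MeasurableSet {v | m * H v ≤ C * J v} :=
    measurableSet_le (hHm.const_mul m) (hJm.const_mul C)
  -- The exceptional set is measurable and misses `Λ'`, so it meets the hull in a null set.
  have hae : ∀ᵐ v ∂(σ.restrict (toMeasurable σ Λ')), m * H v ≤ C * J v := by
    rw [ae_restrict_iff' (measurableSet_toMeasurable _ _), ae_iff]
    have h1 : {v | ¬ (v ∈ toMeasurable σ Λ' → m * H v ≤ C * J v)} =
        toMeasurable σ Λ' ∩ {v | m * H v ≤ C * J v}ᶜ := by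
      ext v
      simp
    rw [h1, Measure.measure_toMeasurable_inter hMm.compl (measure_ne_top _ _)]
    have h2 : Λ' ∩ {v | m * H v ≤ C * J v}ᶜ = ∅ := by
      rw [← sdiff_eq, sdiff_eq_empty]
      exact hray
    rw [h2, measure_empty]
  calc m * ∫⁻ z in coneAnnulus (toMeasurable σ Λ') θ₀ (1 - η), projIncr p u (δ • z)
      ≤ m * ∫⁻ v in toMeasurable σ Λ', H v ∂σ := by
        gcongr
        rw [setLIntegral_coneAnnulus (measurableSet_toMeasurable _ _) hθ₀.le _ (by fun_prop)]
        refine lintegral_mono fun v => setLIntegral_mono' measurableSet_Ioo fun r hr => ?_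
        rw [smul_smul]
        refine mul_le_of_le_one_right' (ENNReal.ofReal_le_one.2 (pow_le_one₀ ?_ ?_))
        · linarith [hr.1]
        · linarith [hr.2]
    _ ≤ ∫⁻ v in toMeasurable σ Λ', m * H v ∂σ := lintegral_const_mul_le _ _
    _ ≤ ∫⁻ v in toMeasurable σ Λ', C * J v ∂σ := lintegral_mono_ae hae
    _ ≤ ∫⁻ v, C * J v ∂σ := setLIntegral_le_lintegral _ _
    _ = C * ∫⁻ v, J v ∂σ := lintegral_const_mul _ hJm
    _ = _ := by
        rw [lintegral_eq_lintegral_toSphere volume (by fun_prop)]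
        congr 1
        refine lintegral_congr fun v => setLIntegral_congr_fun measurableSet_Ioi fun r hr => ?_
        have hr : 0 < r := hr
        rw [norm_smul, norm_eq_of_mem_sphere, mul_one, Real.norm_of_nonneg hr.le]

end Cone

/-! ### The seminorm as a weighted integral of increments. -/

section Seminorm

/-- Substitute `y = x + h` and exchange the integrals. One factor `|h|⁻¹` becomes `|h|^{-p}`, the
other normalises the direction. -/
theorem seminormPow_eq_lintegral_projIncr {d : ℕ} {p : ℝ} (hp : 0 ≤ p)
    {ρ : EuclideanSpace ℝ (Fin d) → ℝ} {w : EuclideanSpace ℝ (Fin d) → ℝ≥0∞} (hw : Measurable w)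
    (hρw : (fun x => ENNReal.ofReal (ρ x)) =ᵐ[volume] w)
    {u u' : EuclideanSpace ℝ (Fin d) → EuclideanSpace ℝ (Fin d)} (hu' : Measurable u')
    (huu' : u =ᵐ[volume] u') :
    seminormPow ρ p u = ∫⁻ h, w h * projIncr p u' h * ENNReal.ofReal (‖h‖ ^ (-p)) := by
  let G : EuclideanSpace ℝ (Fin d) → EuclideanSpace ℝ (Fin d) → ℝ≥0∞ := fun x h =>
    ENNReal.ofReal (‖h‖ ^ (-p)) * w h * ‖inner ℝ (u' (x + h) - u' x) (‖h‖⁻¹ • h)‖ₑ ^ p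
  have h1 : ∀ᵐ x, ∫⁻ y, ENNReal.ofReal (ρ (y - x) * |projDiffQuotient u x y| ^ p) =
      ∫⁻ h, G x h := by
    filter_upwards [huu'] with x hx
    rw [← lintegral_add_left_eq_self _ x]
    refine lintegral_congr_ae ?_
    filter_upwards [(measurePreserving_add_left volume x).quasiMeasurePreserving.ae huu', hρw]
      with h hxh hρh
    rw [add_sub_cancel_left, ENNReal.ofReal_mul' (by positivity), hρh, projDiffQuotient,
      add_sub_cancel_left, hx, hxh, real_inner_smul_left, abs_mul,
      Real.mul_rpow (abs_nonneg _) (abs_nonneg _), abs_of_nonneg (inv_nonneg.2 (norm_nonneg h)),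
      Real.inv_rpow (norm_nonneg h), ← Real.rpow_neg (norm_nonneg h),
      ENNReal.ofReal_mul (by positivity), ← ENNReal.ofReal_rpow_of_nonneg (abs_nonneg _) hp,
      ← Real.enorm_eq_ofReal_abs]
    ring
  have hG : Measurable (Function.uncurry G) := by
    simp only [G, Function.uncurry_def]
    fun_prop
  rw [seminormPow, lintegral_congr_ae h1, lintegral_lintegral_swap hG.aemeasurable]
  refine lintegral_congr fun h => ?_
  rw [lintegral_const_mul _ (by fun_prop), projIncr]
  ring

end Seminorm

/-! ### Jensen's inequality. -/

section Jensen

/-- Hölder applied to `m φ = m^{1-1/p} (m φ^p)^{1/p}`, with no normalisation of the mass of `m`. -/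
theorem rpow_lintegral_mul_le {α : Type*} [MeasurableSpace α] {μ : Measure α} {p : ℝ} (hp : 1 ≤ p)
    {m φ : α → ℝ≥0∞} (hm : AEMeasurable m μ) (hφ : AEMeasurable φ μ) :
    (∫⁻ a, m a * φ a ∂μ) ^ p ≤ (∫⁻ a, m a ∂μ) ^ (p - 1) * ∫⁻ a, m a * φ a ^ p ∂μ := by
  have hp0 : 0 < p := by linarith
  have hp1 : 0 ≤ 1 - p⁻¹ := sub_nonneg.2 (inv_le_one_of_one_le₀ hp)
  have h := ENNReal.lintegral_mul_norm_pow_le hm (hm.mul (hφ.pow_const p)) hp1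
    (inv_nonneg.2 hp0.le) (by ring)
  have h1 : ∀ a, m a ^ (1 - p⁻¹) * (m a * φ a ^ p) ^ p⁻¹ = m a * φ a := by
    intro a
    rw [ENNReal.mul_rpow_of_nonneg _ _ (by positivity), ← mul_assoc,
      ← ENNReal.rpow_add_of_nonneg _ _ hp1 (by positivity), ← ENNReal.rpow_mul,
      mul_inv_cancel₀ hp0.ne', sub_add_cancel, ENNReal.rpow_one, ENNReal.rpow_one]
  simp only [Pi.mul_apply, h1] at h
  calc _ ≤ ((∫⁻ a, m a ∂μ) ^ (1 - p⁻¹) * (∫⁻ a, m a * φ a ^ p ∂μ) ^ p⁻¹) ^ p := by gcongr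
    _ = _ := by
      rw [ENNReal.mul_rpow_of_nonneg _ _ hp0.le, ← ENNReal.rpow_mul, ← ENNReal.rpow_mul,
        inv_mul_cancel₀ hp0.ne', ENNReal.rpow_one, sub_mul, inv_mul_cancel₀ hp0.ne', one_mul]

end Jensen

/-! ### Recovering a vector from its projections onto lines. -/

section Projection

variable {E : Type*} [NormedAddCommGroup E] [InnerProductSpace ℝ E]

/-- The orthogonal projection onto the line spanned by `z`. -/
noncomputable def lineProj (z : E) : E →L[ℝ] E :=
  (innerSL ℝ (‖z‖⁻¹ • z)).smulRight (‖z‖⁻¹ • z)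

theorem lineProj_apply (z ξ : E) : lineProj z ξ = inner ℝ ξ (‖z‖⁻¹ • z) • (‖z‖⁻¹ • z) := by
  rw [lineProj, ContinuousLinearMap.smulRight_apply, innerSL_apply_apply, real_inner_comm]

theorem norm_inv_norm_smul_le (z : E) : ‖‖z‖⁻¹ • z‖ ≤ 1 := by
  rw [norm_smul, norm_inv, norm_norm]
  exact inv_mul_le_one

theorem norm_lineProj_apply_le (z ξ : E) : ‖lineProj z ξ‖ ≤ |inner ℝ ξ (‖z‖⁻¹ • z)| := by
  rw [lineProj_apply, norm_smul, Real.norm_eq_abs]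
  exact mul_le_of_le_one_right (abs_nonneg _) (norm_inv_norm_smul_le z)

theorem norm_lineProj_le (z : E) : ‖lineProj z‖ ≤ 1 := by
  refine ContinuousLinearMap.opNorm_le_bound _ zero_le_one fun ξ => ?_
  refine (norm_lineProj_apply_le z ξ).trans ((abs_real_inner_le_norm _ _).trans ?_)
  rw [mul_comm]
  gcongr
  exact norm_inv_norm_smul_le z

theorem stronglyMeasurable_clm_apply {α : Type*} [MeasurableSpace α] {κ : α → E →L[ℝ] E}
    {u : α → E} (hκ : StronglyMeasurable κ) (hu : StronglyMeasurable u) :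
    StronglyMeasurable fun z => κ z (u z) :=
  isBoundedBilinearMap_apply.continuous.comp_stronglyMeasurable (hκ.prodMk hu)

variable [FiniteDimensional ℝ E] [MeasurableSpace E] [BorelSpace E]

theorem stronglyMeasurable_lineProj : StronglyMeasurable (lineProj : E → E →L[ℝ] E) := by
  have h : StronglyMeasurable fun z : E => ‖z‖⁻¹ • z := by
    have : Measurable fun z : E => ‖z‖⁻¹ • z := by fun_prop
    exact this.stronglyMeasurable
  have hc : Continuous fun e : E => (innerSL ℝ e).smulRight e := by fun_prop
  exact hc.comp_stronglyMeasurable h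

/-- The average of the projections onto the lines spanned by the points of a set of positive
measure is invertible. -/
theorem exists_comp_integral_lineProj (μ : Measure E) [μ.IsAddHaarMeasure] {A : Set E}
    (hA : MeasurableSet A) (hA0 : μ A ≠ 0) (hAfin : μ A ≠ ∞) :
    ∃ P : E →L[ℝ] E, ∫ z in A, P ∘L lineProj z ∂μ = ContinuousLinearMap.id ℝ E := by
  have hint : Integrable (fun z => lineProj z) (μ.restrict A) := by
    refine Measure.integrableOn_of_bounded (M := 1) hAfin
      stronglyMeasurable_lineProj.aestronglyMeasurable ?_
    exact Eventually.of_forall norm_lineProj_le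
  set Q := ∫ z in A, lineProj z ∂μ with hQ
  have hQi : ∀ ξ, inner ℝ ξ (Q ξ) = ∫ z in A, (inner ℝ ξ (‖z‖⁻¹ • z)) ^ 2 ∂μ := by
    intro ξ
    rw [hQ, ContinuousLinearMap.integral_apply hint,
      ← integral_inner (hint.apply_continuousLinearMap ξ)]
    congr 1 with z
    rw [lineProj_apply, inner_smul_right, sq]
  -- If `Q ξ = 0`, the squares integrate to zero, so almost all of `A` lies in the proper subspace
  -- `ξᗮ`, which is null.
  have hinj : Function.Injective Q := by
    rw [injective_iff_map_eq_zero]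
    intro ξ hξ
    by_contra hξ0
    have h0 := hQi ξ
    have hint2 : Integrable (fun z => (inner ℝ ξ (‖z‖⁻¹ • z)) ^ 2) (μ.restrict A) := by
      have := (hint.apply_continuousLinearMap ξ).const_inner ξ (𝕜 := ℝ)
      refine this.congr (Eventually.of_forall fun z => ?_)
      simp only [lineProj_apply, inner_smul_right, sq]
    rw [hξ, inner_zero_right, eq_comm, integral_eq_zero_iff_of_nonneg (fun _ => sq_nonneg _) hint2,
      Filter.EventuallyEq, ae_restrict_iff' hA] at h0
    have hnull := Measure.addHaar_submodule μ (ℝ ∙ ξ)ᗮ (by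
      intro h
      rw [Submodule.orthogonal_eq_top_iff, Submodule.span_singleton_eq_bot] at h
      exact hξ0 h)
    refine hA0 (measure_eq_zero_iff_ae_notMem.2 ?_)
    filter_upwards [h0, measure_eq_zero_iff_ae_notMem.1 hnull] with z hz hz' hzA
    have h1 := hz hzA
    rw [Pi.zero_apply, inner_smul_right, sq_eq_zero_iff, mul_eq_zero, inv_eq_zero,
      norm_eq_zero] at h1
    refine hz' (Submodule.mem_orthogonal_singleton_iff_inner_right.2 ?_)
    rcases h1 with h1 | h1
    · rw [h1, inner_zero_right]
    · exact h1
  set e : E ≃L[ℝ] E :=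
    (LinearEquiv.ofInjectiveEndo (Q : E →ₗ[ℝ] E) hinj).toContinuousLinearEquiv with he
  refine ⟨(e.symm : E →L[ℝ] E), ?_⟩
  have h := ((ContinuousLinearMap.compL ℝ E E E) (e.symm : E →L[ℝ] E)).integral_comp_comm hint
  simp only [ContinuousLinearMap.compL_apply] at h
  rw [h, ← hQ]
  ext1 ξ
  exact e.symm_apply_apply ξ

end Projection

/-! ### Convolution with matrix kernels. -/

section Kernel

variable {E : Type*} [NormedAddCommGroup E] [InnerProductSpace ℝ E] [FiniteDimensional ℝ E]
  [MeasureSpace E] [BorelSpace E]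

/-- The convolution (with reflected argument) of a vector field with an operator valued kernel. -/
noncomputable def kernelConv (κ : E → E →L[ℝ] E) (u : E → E) (x : E) : E :=
  ∫ z, κ z (u (x + z))

theorem stronglyMeasurable_kernelConv [SFinite (volume : Measure E)] {κ : E → E →L[ℝ] E}
    (hκ : StronglyMeasurable κ) {u : E → E} (hu : Measurable u) :
    StronglyMeasurable (kernelConv κ u) := by
  refine StronglyMeasurable.integral_prod_right (f := fun x z => κ z (u (x + z))) ?_
  exact stronglyMeasurable_clm_apply (hκ.comp_measurable measurable_snd)
    (hu.comp (measurable_fst.add measurable_snd)).stronglyMeasurable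

variable [(volume : Measure E).IsAddHaarMeasure]

theorem integrable_kernel_apply {κ : E → E →L[ℝ] E} (hκ : StronglyMeasurable κ) {M R : ℝ}
    (hM : ∀ z, ‖κ z‖ ≤ M) (hR : ∀ z, R < ‖z‖ → κ z = 0) {u : E → E} (hu : Measurable u)
    (huloc : LocallyIntegrable u volume) (x : E) : Integrable fun z => κ z (u (x + z)) := by
  have hint : IntegrableOn (fun z => u (x + z)) (Metric.closedBall 0 R) := by
    have h := (measurePreserving_add_left volume x).integrableOn_comp_preimage
      (measurableEmbedding_addLeft x) (f := u) (s := Metric.closedBall x R)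
    refine (h.2 (huloc.integrableOn_isCompact (isCompact_closedBall x R))).mono_set fun z hz => ?_
    simpa using hz
  rw [← integrable_indicator_iff Metric.isClosed_closedBall.measurableSet] at hint
  refine (hint.norm.const_mul M).mono'
    (stronglyMeasurable_clm_apply hκ
      (hu.comp (measurable_const_add x)).stronglyMeasurable).aestronglyMeasurable
    (Eventually.of_forall fun z => ?_)
  by_cases hz : z ∈ Metric.closedBall (0 : E) R
  · rw [indicator_of_mem hz]
    exact ((κ z).le_opNorm _).trans (by gcongr; exact hM z)
  · rw [indicator_of_notMem hz, hR z (by simpa using hz)]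
    simp

/-- Young's inequality. -/
theorem lintegral_enorm_kernelConv_rpow_le {p : ℝ} (hp : 1 ≤ p) {κ : E → E →L[ℝ] E}
    (hκ : StronglyMeasurable κ) {u : E → E} (hu : Measurable u) :
    ∫⁻ x, ‖kernelConv κ u x‖ₑ ^ p ≤ (∫⁻ z, ‖κ z‖ₑ) ^ p * ∫⁻ x, ‖u x‖ₑ ^ p := by
  have hκm : Measurable fun z => ‖κ z‖ₑ := hκ.enorm
  have hpt : ∀ x, ‖kernelConv κ u x‖ₑ ^ p ≤
      (∫⁻ z, ‖κ z‖ₑ) ^ (p - 1) * ∫⁻ z, ‖κ z‖ₑ * ‖u (x + z)‖ₑ ^ p := by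
    intro x
    calc ‖kernelConv κ u x‖ₑ ^ p ≤ (∫⁻ z, ‖κ z‖ₑ * ‖u (x + z)‖ₑ) ^ p := by
          gcongr
          refine (enorm_integral_le_lintegral_enorm _).trans (lintegral_mono fun z => ?_)
          exact (κ z).le_opENorm _
      _ ≤ _ := rpow_lintegral_mul_le hp hκm.aemeasurable (by fun_prop)
  have hswap : ∫⁻ x, ∫⁻ z, ‖κ z‖ₑ * ‖u (x + z)‖ₑ ^ p = (∫⁻ z, ‖κ z‖ₑ) * ∫⁻ x, ‖u x‖ₑ ^ p := by
    rw [lintegral_lintegral_swap (by fun_prop), ← lintegral_mul_const _ hκm]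
    refine lintegral_congr fun z => ?_
    rw [lintegral_const_mul _ (by fun_prop)]
    congr 1
    exact lintegral_add_right_eq_self (fun x => ‖u x‖ₑ ^ p) z
  calc _ ≤ ∫⁻ x, (∫⁻ z, ‖κ z‖ₑ) ^ (p - 1) * ∫⁻ z, ‖κ z‖ₑ * ‖u (x + z)‖ₑ ^ p := lintegral_mono hpt
    _ = (∫⁻ z, ‖κ z‖ₑ) ^ (p - 1) * ((∫⁻ z, ‖κ z‖ₑ) * ∫⁻ x, ‖u x‖ₑ ^ p) := by
        rw [lintegral_const_mul, hswap]
        exact Measurable.lintegral_prod_right' (f := fun q : E × E => ‖κ q.2‖ₑ * ‖u (q.1 + q.2)‖ₑ ^ p)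
          (by fun_prop)
    _ = _ := by
        rw [← mul_assoc]
        congr 1
        conv_lhs => rw [← ENNReal.rpow_one (∫⁻ z, ‖κ z‖ₑ), ← ENNReal.rpow_mul, one_mul,
          ← ENNReal.rpow_add_of_nonneg _ _ (by linarith) zero_le_one, sub_add_cancel]

/-- Averaging `u` over `δ A` with a matrix kernel that only sees the components along the
displacement. -/
theorem exists_kernel_approx {p : ℝ} (hp : 1 ≤ p) {A : Set E} (hA : MeasurableSet A)
    (hA0 : volume A ≠ 0) {R : ℝ} (hAR : A ⊆ Metric.closedBall 0 R) :
    ∃ C : ℝ≥0∞, C ≠ ∞ ∧ ∀ δ : ℝ, 0 < δ → ∃ κ : E → E →L[ℝ] E, StronglyMeasurable κ ∧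
      (∃ M, ∀ z, ‖κ z‖ ≤ M) ∧ (∃ R', ∀ z, R' < ‖z‖ → κ z = 0) ∧
      ∀ u : E → E, Measurable u → LocallyIntegrable u volume →
        ∫⁻ x, ‖u x - kernelConv κ u x‖ₑ ^ p ≤ C * ∫⁻ z in A, projIncr p u (δ • z) := by
  have hAfin : volume A ≠ ∞ := ((measure_mono hAR).trans_lt measure_closedBall_lt_top).ne
  obtain ⟨P, hP⟩ := exists_comp_integral_lineProj volume hA hA0 hAfin
  let k : E → E →L[ℝ] E := A.indicator fun z => P ∘L lineProj z
  have hkm' : StronglyMeasurable fun z : E => P ∘L lineProj z :=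
    ((ContinuousLinearMap.compL ℝ E E E) P).continuous.comp_stronglyMeasurable
      stronglyMeasurable_lineProj
  have hkm : StronglyMeasurable k := hkm'.indicator hA
  have hkM : ∀ z, ‖k z‖ ≤ ‖P‖ := by
    intro z
    refine (norm_indicator_le_norm_self _ _).trans ((P.opNorm_comp_le _).trans ?_)
    exact mul_le_of_le_one_right (norm_nonneg _) (norm_lineProj_le z)
  have hkR : ∀ z, R < ‖z‖ → k z = 0 := by
    intro z hz
    refine indicator_of_notMem (fun h => ?_) _
    have := hAR h
    rw [mem_closedBall_zero_iff] at this
    linarith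
  refine ⟨‖P‖ₑ ^ p * volume A ^ (p - 1),
    ENNReal.mul_ne_top (ENNReal.rpow_ne_top_of_nonneg (by linarith) enorm_ne_top)
      (ENNReal.rpow_ne_top_of_nonneg (by linarith) hAfin), fun δ hδ => ?_⟩
  set N := Module.finrank ℝ E
  refine ⟨fun z => (δ ^ N)⁻¹ • k (δ⁻¹ • z),
    (hkm.comp_measurable (measurable_const_smul δ⁻¹)).const_smul (δ ^ N)⁻¹, ⟨(δ ^ N)⁻¹ * ‖P‖, fun z => ?_⟩,
    ⟨δ * R, fun z hz => ?_⟩, fun u hu huloc => ?_⟩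
  · rw [norm_smul, Real.norm_of_nonneg (by positivity)]
    gcongr
    exact hkM _
  · beta_reduce
    rw [hkR, smul_zero]
    rwa [norm_smul, Real.norm_of_nonneg (by positivity), lt_inv_mul_iff₀ hδ]
  have hint : ∀ x, Integrable fun z => k z (u (x + δ • z)) := by
    intro x
    have := integrable_kernel_apply (κ := fun z => k (δ⁻¹ • z)) (R := δ * R)
      (hkm.comp_measurable (measurable_const_smul _)) (fun z => hkM _) (fun z hz => by
        apply hkR
        rwa [norm_smul, Real.norm_of_nonneg (by positivity), lt_inv_mul_iff₀ hδ]) hu huloc x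
    have h2 := this.comp_smul hδ.ne'
    simpa only [smul_smul, inv_mul_cancel₀ hδ.ne', one_smul] using h2
  have hconv : ∀ x, kernelConv (fun z => (δ ^ N)⁻¹ • k (δ⁻¹ • z)) u x =
      ∫ z, k z (u (x + δ • z)) := by
    intro x
    have := Measure.integral_comp_smul_of_nonneg volume
      (fun z => k (δ⁻¹ • z) (u (x + z))) δ (hR := hδ.le)
    simp only [smul_smul, inv_mul_cancel₀ hδ.ne', one_smul] at this
    rw [this, kernelConv, ← integral_smul]
    rfl
  have hkint : Integrable k := by
    refine IntegrableOn.integrable_indicator (f := fun z => P ∘L lineProj z) ?_ hA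
    refine Measure.integrableOn_of_bounded (M := ‖P‖) hAfin hkm'.aestronglyMeasurable
      (Eventually.of_forall fun z => (P.opNorm_comp_le _).trans
        (mul_le_of_le_one_right (norm_nonneg _) (norm_lineProj_le z)))
  have hkone : ∀ ξ, ∫ z, k z ξ = ξ := by
    intro ξ
    rw [← ContinuousLinearMap.integral_apply hkint, integral_indicator hA, hP]
    rfl
  have hdir : ∀ z : E, ‖δ • z‖⁻¹ • δ • z = ‖z‖⁻¹ • z := by
    intro z
    rw [norm_smul, Real.norm_of_nonneg hδ.le, smul_smul, mul_inv, mul_right_comm,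
      inv_mul_cancel₀ hδ.ne', one_mul]
  have hpt : ∀ x, ‖u x - kernelConv (fun z => (δ ^ N)⁻¹ • k (δ⁻¹ • z)) u x‖ₑ ^ p ≤
      ‖P‖ₑ ^ p * volume A ^ (p - 1) *
        ∫⁻ z in A, ‖inner ℝ (u (x + δ • z) - u x) (‖δ • z‖⁻¹ • δ • z)‖ₑ ^ p := by
    intro x
    have h1 : ‖u x - kernelConv (fun z => (δ ^ N)⁻¹ • k (δ⁻¹ • z)) u x‖ₑ ≤
        ‖P‖ₑ * ∫⁻ z in A, 1 * ‖inner ℝ (u (x + δ • z) - u x) (‖δ • z‖⁻¹ • δ • z)‖ₑ := by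
      -- As `k` integrates to the identity, the difference is an average of `k z` applied to
      -- increments of `u`, and `lineProj z` keeps only their component along `z`.
      rw [hconv, ← hkone (u x), enorm_sub_rev, ← integral_sub (hint x)
        (hkint.apply_continuousLinearMap (u x)), ← lintegral_const_mul _ (by fun_prop),
        ← lintegral_indicator hA]
      refine (enorm_integral_le_lintegral_enorm _).trans (lintegral_mono fun z => ?_)
      by_cases hz : z ∈ A
      · rw [indicator_of_mem hz, ← map_sub, hkone, hdir, one_mul]
        simp only [k, indicator_of_mem hz, ContinuousLinearMap.comp_apply]
        refine (P.le_opENorm _).trans ?_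
        gcongr
        rw [enorm_le_iff_norm_le]
        exact norm_lineProj_apply_le _ _
      · simp [k, indicator_of_notMem hz]
    calc _ ≤ (‖P‖ₑ * ∫⁻ z in A, 1 * ‖inner ℝ (u (x + δ • z) - u x) (‖δ • z‖⁻¹ • δ • z)‖ₑ) ^ p := by
          gcongr
      _ ≤ _ := by
          rw [ENNReal.mul_rpow_of_nonneg _ _ (by linarith), mul_assoc]
          gcongr
          refine (rpow_lintegral_mul_le hp (by fun_prop) (by fun_prop)).trans ?_
          simp
  have hmeas : Measurable fun q : E × E =>
      ‖inner ℝ (u (q.1 + δ • q.2) - u q.1) (‖δ • q.2‖⁻¹ • δ • q.2)‖ₑ ^ p := by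
    fun_prop
  calc _ ≤ ∫⁻ x, ‖P‖ₑ ^ p * volume A ^ (p - 1) *
        ∫⁻ z in A, ‖inner ℝ (u (x + δ • z) - u x) (‖δ • z‖⁻¹ • δ • z)‖ₑ ^ p := lintegral_mono hpt
    _ = _ := by
        rw [lintegral_const_mul _ hmeas.lintegral_prod_right',
          lintegral_lintegral_swap hmeas.aemeasurable]
        rfl

end Kernel

/-! ### Total boundedness by uniform approximation. -/

section TotallyBounded

/-- Choosing an index for each point of a finite net of `range Φ` gives a finite net of `range f`.
-/
theorem exists_finite_range_subset_of_dist_lt {ι X Y : Type*} [PseudoMetricSpace X]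
    [PseudoMetricSpace Y] {f : ι → X} {η ε : ℝ} (hη : 0 < η) {Φ : ι → Y}
    (hΦ : TotallyBounded (range Φ)) (h : ∀ i j, dist (Φ i) (Φ j) < η → dist (f i) (f j) < ε) :
    ∃ t : Set X, t.Finite ∧ range f ⊆ ⋃ y ∈ t, Metric.ball y ε := by
  obtain ⟨t, hts, htf, ht⟩ := Metric.finite_approx_of_totallyBounded hΦ η hη
  choose g hg using fun y : t => hts y.2
  have : Finite t := htf
  refine ⟨range fun y : t => f (g y), finite_range _, ?_⟩
  rintro _ ⟨i, rfl⟩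
  obtain ⟨y, hy, hiy⟩ := mem_iUnion₂.1 (ht (mem_range_self i))
  refine mem_iUnion₂.2 ⟨f (g ⟨y, hy⟩), mem_range_self _, h _ _ ?_⟩
  rw [hg]
  exact hiy

/-- A family of functions that are uniformly bounded and uniformly equicontinuous on a totally
bounded set is totally bounded for the uniform distance. -/
theorem exists_totallyBounded_of_equicontinuousOn {ι α F : Type*} [PseudoMetricSpace α]
    [NormedAddCommGroup F] [ProperSpace F] {D : Set α} (hD : TotallyBounded D) {B : ι → α → F}
    (hB : ∃ M, ∀ i, ∀ x ∈ D, ‖B i x‖ ≤ M)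
    (hBc : ∀ η > 0, ∃ r > 0, ∀ i, ∀ x ∈ D, ∀ y ∈ D, dist x y < r → dist (B i x) (B i y) ≤ η)
    {ε : ℝ} (hε : 0 < ε) :
    ∃ (t : Finset α) (Φ : ι → t → F), TotallyBounded (range Φ) ∧
      ∀ i j, dist (Φ i) (Φ j) < ε / 3 → ∀ x ∈ D, ‖B i x - B j x‖ ≤ ε := by
  obtain ⟨M, hM⟩ := hB
  obtain ⟨r, hr, hBr⟩ := hBc (ε / 3) (by positivity)
  obtain ⟨t, htD, htf, ht⟩ := Metric.finite_approx_of_totallyBounded hD r hr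
  refine ⟨htf.toFinset, fun i x => B i x, ?_, fun i j hij x hx => ?_⟩
  · have hb : Bornology.IsBounded (range fun (i : ι) (x : htf.toFinset) => B i x) := by
      refine (Metric.isBounded_closedBall (x := 0) (r := max M 0)).subset ?_
      rintro _ ⟨i, rfl⟩
      rw [mem_closedBall_zero_iff, pi_norm_le_iff_of_nonneg (le_max_right _ _)]
      intro x
      exact (hM i x (htD (htf.mem_toFinset.1 x.2))).trans (le_max_left _ _)
    exact hb.isCompact_closure.totallyBounded.subset subset_closure
  · obtain ⟨y, hy, hxy⟩ := mem_iUnion₂.1 (ht hx)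
    have h1 := hBr i x hx y (htD hy) hxy
    have h2 := hBr j y (htD hy) x hx (by rwa [dist_comm])
    have h3 := (dist_le_pi_dist (fun x : htf.toFinset => B i x) (fun x => B j x)
      ⟨y, htf.mem_toFinset.2 hy⟩).trans hij.le
    rw [← dist_eq_norm]
    have h4 := dist_triangle4 (B i x) (B i y) (B j y) (B j x)
    simp only at h3
    linarith

/-- A family in `L^p` that can be approximated uniformly well by bounded equicontinuous families
is totally bounded. -/
theorem totallyBounded_range_toLp {ι α F : Type*} [PseudoMetricSpace α] [MeasurableSpace α]
    [NormedAddCommGroup F] [ProperSpace F] {μ : Measure α} [IsFiniteMeasure μ] {D : Set α}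
    (hD : TotallyBounded D) (hμD : ∀ᵐ x ∂μ, x ∈ D) {p : ℝ≥0∞} [hp : Fact (1 ≤ p)]
    {u : ι → α → F} (hu : ∀ i, MemLp (u i) p μ)
    (H : ∀ ε : ℝ, 0 < ε → ∃ B : ι → α → F, (∀ i, AEStronglyMeasurable (B i) μ) ∧
      (∀ i, eLpNorm (u i - B i) p μ ≤ ENNReal.ofReal ε) ∧
      (∃ M, ∀ i, ∀ x ∈ D, ‖B i x‖ ≤ M) ∧
      ∀ η > 0, ∃ r > 0, ∀ i, ∀ x ∈ D, ∀ y ∈ D, dist x y < r → dist (B i x) (B i y) ≤ η) :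
    TotallyBounded (range fun i => ((hu i).toLp (u i) : Lp F p μ)) := by
  rw [Metric.totallyBounded_iff]
  intro ε hε
  obtain ⟨B, hBm, hBε, hBb, hBc⟩ := H (ε / 4) (by positivity)
  set V : ℝ := (μ univ ^ p.toReal⁻¹).toReal with hV
  have hVtop : μ univ ^ p.toReal⁻¹ ≠ ∞ :=
    ENNReal.rpow_ne_top_of_nonneg (by positivity) (measure_ne_top _ _)
  have hV0 : 0 ≤ V := ENNReal.toReal_nonneg
  -- A uniform distance below this costs at most `ε/4` in `L^p`; the `+ 1` covers `V = 0`.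
  have hη : 0 < ε / (4 * (V + 1)) := by positivity
  obtain ⟨t, Φ, hΦ, hΦB⟩ := exists_totallyBounded_of_equicontinuousOn hD hBb hBc hη
  refine exists_finite_range_subset_of_dist_lt (η := ε / (4 * (V + 1)) / 3) (by positivity) hΦ
    fun i j hij => ?_
  have hBB : eLpNorm (B i - B j) p μ ≤ ENNReal.ofReal (ε / 4) := by
    refine (eLpNorm_le_of_ae_bound (C := ε / (4 * (V + 1))) ?_).trans ?_
    · filter_upwards [hμD] with x hx using hΦB i j hij x hx
    · rw [← ENNReal.ofReal_toReal hVtop, ← ENNReal.ofReal_mul ENNReal.toReal_nonneg]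
      refine ENNReal.ofReal_le_ofReal ?_
      rw [← hV, mul_div_assoc', div_le_div_iff₀ (by positivity) (by positivity)]
      nlinarith
  have hsub : u i - u j = (u i - B i) + ((B i - B j) + (B j - u j)) := by abel
  have hle : eLpNorm (u i - u j) p μ ≤
      ENNReal.ofReal (ε / 4) + (ENNReal.ofReal (ε / 4) + ENNReal.ofReal (ε / 4)) := by
    rw [hsub]
    refine (eLpNorm_add_le ((hu i).1.sub (hBm i))
      (((hBm i).sub (hBm j)).add ((hBm j).sub (hu j).1)) hp.out).trans ?_
    refine add_le_add (hBε i) ?_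
    refine (eLpNorm_add_le ((hBm i).sub (hBm j)) ((hBm j).sub (hu j).1) hp.out).trans ?_
    refine add_le_add hBB ?_
    rw [eLpNorm_sub_comm]
    exact hBε j
  rw [← ENNReal.ofReal_add (by positivity) (by positivity),
    ← ENNReal.ofReal_add (by positivity) (by positivity)] at hle
  rw [← edist_lt_ofReal, Lp.edist_toLp_toLp]
  exact hle.trans_lt ((ENNReal.ofReal_lt_ofReal_iff hε).2 (by linarith))

end TotallyBounded

/-! ### Boundedness and equicontinuity of the convolutions. -/

section Equicontinuity

variable {E : Type*} [NormedAddCommGroup E] [InnerProductSpace ℝ E] [MeasureSpace E]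

/-- Moves `x` into the kernel, so that regularity in `x` comes from `κ` alone. -/
theorem kernelConv_eq_integral_sub [BorelSpace E] [(volume : Measure E).IsAddHaarMeasure]
    (κ : E → E →L[ℝ] E) (u : E → E) (x : E) :
    kernelConv κ u x = ∫ y, κ (y - x) (u y) := by
  rw [kernelConv, ← integral_add_left_eq_self (fun y => κ (y - x) (u y)) x]
  simp

variable [FiniteDimensional ℝ E]

/-- Hölder on a ball of finite measure. -/
theorem exists_setIntegral_norm_le [(volume : Measure E).IsAddHaarMeasure]
    {ι : Type*} {u : ι → E → E} {p : ℝ≥0∞} (hp : 1 ≤ p) (hu : ∀ i, MemLp (u i) p volume)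
    {C : ℝ≥0∞} (hC : C ≠ ∞) (huC : ∀ i, eLpNorm (u i) p volume ≤ C) (R : ℝ) :
    ∃ L, ∀ i, ∫ z in Metric.closedBall (0 : E) R, ‖u i z‖ ≤ L := by
  set ν := (volume : Measure E).restrict (Metric.closedBall 0 R) with hν
  have hfin : IsFiniteMeasure ν :=
    ⟨by rw [hν, Measure.restrict_apply_univ]; exact measure_closedBall_lt_top⟩
  set b := C * ν univ ^ (1 / (1 : ℝ≥0∞).toReal - 1 / p.toReal) with hb
  have hbtop : b ≠ ∞ := by
    refine ENNReal.mul_ne_top hC (ENNReal.rpow_ne_top_of_nonneg ?_ (measure_ne_top _ _))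
    rcases eq_or_ne p ∞ with rfl | hpt
    · simp
    · have : 1 ≤ p.toReal := by
        rw [← ENNReal.toReal_one]
        exact ENNReal.toReal_mono hpt hp
      rw [ENNReal.toReal_one, div_one, one_div, sub_nonneg]
      exact inv_le_one_of_one_le₀ this
  refine ⟨b.toReal, fun i => ?_⟩
  rw [integral_norm_eq_lintegral_enorm (hu i).1.restrict]
  refine ENNReal.toReal_mono hbtop ?_
  rw [← eLpNorm_one_eq_lintegral_enorm]
  refine (eLpNorm_le_eLpNorm_mul_rpow_measure_univ hp (hu i).1.restrict).trans ?_
  rw [hb]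
  gcongr
  exact (eLpNorm_mono_measure _ Measure.restrict_le_self).trans (huC i)

variable [BorelSpace E]

theorem norm_integral_kernel_apply_le {K : E → E →L[ℝ] E} {c R : ℝ} (hc : ∀ z, ‖K z‖ ≤ c)
    (hR : ∀ z, R < ‖z‖ → K z = 0) {u : E → E} (hu : LocallyIntegrable u volume) :
    ‖∫ z, K z (u z)‖ ≤ c * ∫ z in Metric.closedBall 0 R, ‖u z‖ := by
  have hint := (hu.integrableOn_isCompact (isCompact_closedBall (0 : E) R)).norm
  rw [← integral_const_mul, ← integral_indicator Metric.isClosed_closedBall.measurableSet]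
  refine norm_integral_le_of_norm_le
    (IntegrableOn.integrable_indicator (hint.const_mul c) Metric.isClosed_closedBall.measurableSet)
    (Eventually.of_forall fun z => ?_)
  by_cases hz : z ∈ Metric.closedBall (0 : E) R
  · rw [indicator_of_mem hz]
    exact ((K z).le_opNorm _).trans (by gcongr; exact hc z)
  · rw [indicator_of_notMem hz, hR z (by simpa using hz)]
    simp

variable [(volume : Measure E).IsAddHaarMeasure]

variable {ι : Type*} {u : ι → E → E} {κ : E → E →L[ℝ] E}

theorem exists_norm_kernelConv_le (hκ : Continuous κ) (hκc : HasCompactSupport κ)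
    (hu : ∀ i, LocallyIntegrable (u i) volume)
    (hL : ∀ R : ℝ, ∃ L, ∀ i, ∫ z in Metric.closedBall 0 R, ‖u i z‖ ≤ L) (R₀ : ℝ) :
    ∃ M, ∀ i, ∀ x ∈ Metric.closedBall (0 : E) R₀, ‖kernelConv κ (u i) x‖ ≤ M := by
  obtain ⟨c, hc⟩ := hκc.exists_bound_of_continuous hκ
  obtain ⟨R₁, -, hR₁⟩ := hκc.exists_pos_le_norm
  obtain ⟨L, hL⟩ := hL (R₁ + R₀)
  have hc0 : 0 ≤ c := (norm_nonneg _).trans (hc 0)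
  refine ⟨c * L, fun i x hx => ?_⟩
  rw [mem_closedBall_zero_iff] at hx
  rw [kernelConv_eq_integral_sub]
  refine (norm_integral_kernel_apply_le (R := R₁ + R₀) (fun z => hc (z - x)) (fun z hz => ?_)
    (hu i)).trans (by gcongr; exact hL i)
  refine hR₁ _ ?_
  linarith [norm_sub_norm_le z x]

/-- Uniform continuity of `κ` against the uniform `L¹` bound on a ball containing all translated
supports. -/
theorem exists_dist_kernelConv_le (hκ : Continuous κ) (hκc : HasCompactSupport κ)
    (hum : ∀ i, Measurable (u i)) (hu : ∀ i, LocallyIntegrable (u i) volume)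
    (hL : ∀ R : ℝ, ∃ L, ∀ i, ∫ z in Metric.closedBall 0 R, ‖u i z‖ ≤ L) (R₀ : ℝ)
    {η : ℝ} (hη : 0 < η) :
    ∃ r > 0, ∀ i, ∀ x ∈ Metric.closedBall (0 : E) R₀, ∀ y ∈ Metric.closedBall (0 : E) R₀,
      dist x y < r → dist (kernelConv κ (u i) x) (kernelConv κ (u i) y) ≤ η := by
  obtain ⟨c, hc⟩ := hκc.exists_bound_of_continuous hκ
  obtain ⟨R₁, -, hR₁⟩ := hκc.exists_pos_le_norm
  obtain ⟨L, hL⟩ := hL (R₁ + R₀)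
  have hω : 0 < η / (|L| + 1) := by positivity
  obtain ⟨r, hr, hκr⟩ := Metric.uniformContinuous_iff.1
    (hκc.uniformContinuous_of_continuous hκ) _ hω
  have hvan : ∀ x ∈ Metric.closedBall (0 : E) R₀, ∀ z : E, R₁ + R₀ < ‖z‖ → κ (z - x) = 0 := by
    intro x hx z hz
    rw [mem_closedBall_zero_iff] at hx
    exact hR₁ _ (by linarith [norm_sub_norm_le z x])
  have hint : ∀ i, ∀ x ∈ Metric.closedBall (0 : E) R₀, Integrable fun z => κ (z - x) (u i z) := by
    intro i x hx
    have hm : StronglyMeasurable fun z => κ (z - x) := by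
      have : Continuous fun z => κ (z - x) := by fun_prop
      exact this.stronglyMeasurable
    have := integrable_kernel_apply hm (fun z => hc (z - x)) (hvan x hx) (hum i) (hu i) 0
    simpa only [zero_add] using this
  refine ⟨r, hr, fun i x hx y hy hxy => ?_⟩
  rw [dist_eq_norm, kernelConv_eq_integral_sub, kernelConv_eq_integral_sub,
    ← integral_sub (hint i x hx) (hint i y hy)]
  have := norm_integral_kernel_apply_le (K := fun z => κ (z - x) - κ (z - y)) (R := R₁ + R₀)
    (c := η / (|L| + 1)) (fun z => ?_) (fun z hz => ?_) (hu i)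
  · refine this.trans ?_
    calc _ ≤ η / (|L| + 1) * (|L| + 1) := by
          gcongr
          linarith [hL i, le_abs_self L]
      _ = η := by field_simp
  · rw [← dist_eq_norm]
    refine (hκr ?_).le
    rwa [dist_sub_left]
  · rw [hvan x hx z hz, hvan y hy z hz, sub_zero]

end Equicontinuity

/-! ### The compactness criterion. -/

section Compactness

variable {E : Type*} [NormedAddCommGroup E] [InnerProductSpace ℝ E] [FiniteDimensional ℝ E]
  [MeasureSpace E] [BorelSpace E] [(volume : Measure E).IsAddHaarMeasure]

theorem eLpNorm_le_iff_lintegral_rpow_le {α F : Type*} [MeasurableSpace α] {μ : Measure α}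
    [NormedAddCommGroup F] {p : ℝ≥0∞} (hp : 1 ≤ p) (hpt : p ≠ ∞) {f : α → F} {c : ℝ≥0∞} :
    eLpNorm f p μ ≤ c ↔ ∫⁻ x, ‖f x‖ₑ ^ p.toReal ∂μ ≤ c ^ p.toReal := by
  have hp0 : p ≠ 0 := (zero_lt_one.trans_le hp).ne'
  rw [eLpNorm_eq_lintegral_rpow_enorm_toReal hp0 hpt, one_div,
    ENNReal.rpow_inv_le_iff (ENNReal.toReal_pos hp0 hpt)]

theorem eLpNorm_kernelConv_le {p : ℝ≥0∞} (hp : 1 ≤ p) (hpt : p ≠ ∞) {κ : E → E →L[ℝ] E}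
    (hκ : StronglyMeasurable κ) {u : E → E} (hu : Measurable u) :
    eLpNorm (kernelConv κ u) p volume ≤ (∫⁻ z, ‖κ z‖ₑ) * eLpNorm u p volume := by
  have hp1 : 1 ≤ p.toReal := by
    rw [← ENNReal.toReal_one]
    exact ENNReal.toReal_mono hpt hp
  rw [eLpNorm_le_iff_lintegral_rpow_le hp hpt, ENNReal.mul_rpow_of_nonneg _ _ (by linarith)]
  refine (lintegral_enorm_kernelConv_rpow_le hp1 hκ hu).trans ?_
  gcongr
  exact (eLpNorm_le_iff_lintegral_rpow_le hp hpt).1 le_rfl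

/-- A bounded family in `L^p` whose directional increments over small dilations of a set of
positive measure are uniformly small can be approximated by convolutions with a continuous
compactly supported kernel. -/
theorem exists_continuous_kernel_approx {ι : Type*} {u : ι → E → E} {p : ℝ≥0∞} (hp : 1 ≤ p)
    (hpt : p ≠ ∞) (hum : ∀ i, Measurable (u i)) (hu : ∀ i, MemLp (u i) p volume) {C : ℝ≥0∞}
    (hC : C ≠ ∞) (huC : ∀ i, eLpNorm (u i) p volume ≤ C) {A : Set E} (hA : MeasurableSet A)
    (hA0 : volume A ≠ 0) {R : ℝ} (hAR : A ⊆ Metric.closedBall 0 R)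
    (hsmall : ∀ ε : ℝ≥0∞, ε ≠ 0 → ∃ δ : ℝ, 0 < δ ∧
      ∀ i, ∫⁻ z in A, projIncr p.toReal (u i) (δ • z) ≤ ε) {ε : ℝ} (hε : 0 < ε) :
    ∃ κ : E → E →L[ℝ] E, Continuous κ ∧ HasCompactSupport κ ∧
      ∀ i, eLpNorm (u i - kernelConv κ (u i)) p volume ≤ ENNReal.ofReal ε := by
  have hp1 : 1 ≤ p.toReal := by
    rw [← ENNReal.toReal_one]
    exact ENNReal.toReal_mono hpt hp
  set a := ENNReal.ofReal (ε / 2) with ha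
  have ha0 : a ≠ 0 := (ENNReal.ofReal_pos.2 (by positivity)).ne'
  have haq0 : a ^ p.toReal ≠ 0 := by
    rw [Ne, ENNReal.rpow_eq_zero_iff_of_pos (by linarith)]
    exact ha0
  obtain ⟨C₀, hC₀, hker⟩ := exists_kernel_approx hp1 hA hA0 hAR
  -- No case split on `C₀ = 0`: the quotient is then `∞`, and `C₀ * (a ^ p.toReal / C₀) ≤ a ^
  -- p.toReal` still holds.
  obtain ⟨δ, hδ, hδs⟩ := hsmall (a ^ p.toReal / C₀) (ENNReal.div_ne_zero.2 ⟨haq0, hC₀⟩)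
  obtain ⟨κ, hκm, ⟨M, hM⟩, ⟨R', hR'⟩, hκ⟩ := hker δ hδ
  have hκint : Integrable κ := by
    have hball : IntegrableOn κ (Metric.closedBall 0 R') :=
      Measure.integrableOn_of_bounded (M := M) measure_closedBall_lt_top.ne
        hκm.aestronglyMeasurable (Eventually.of_forall hM)
    refine IntegrableOn.integrable_of_forall_notMem_eq_zero (f := κ) hball fun z hz => ?_
    exact hR' z (by simpa using hz)
  -- By Young's inequality, an `L¹` error `a / C` in the kernel costs at most `a` in `L^p`,
  -- uniformly in `i`.
  obtain ⟨κ', hκ'c, hκκ', hκ', hκ'int⟩ := hκint.exists_hasCompactSupport_lintegral_sub_le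
    (ε := a / C) (ENNReal.div_ne_zero.2 ⟨ha0, hC⟩)
  have hκ'm : StronglyMeasurable κ' := hκ'.stronglyMeasurable
  obtain ⟨M', hM'⟩ := hκ'c.exists_bound_of_continuous hκ'
  obtain ⟨R'', -, hR''⟩ := hκ'c.exists_pos_le_norm
  refine ⟨κ', hκ', hκ'c, fun i => ?_⟩
  have huloc := (hu i).locallyIntegrable hp
  have hsplit : u i - kernelConv κ' (u i) =
      (u i - kernelConv κ (u i)) + kernelConv (κ - κ') (u i) := by
    funext x
    have h1 := integrable_kernel_apply hκm hM hR' (hum i) huloc x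
    have h2 := integrable_kernel_apply hκ'm hM' (fun z hz => hR'' z hz.le) (hum i) huloc x
    have h3 : kernelConv (κ - κ') (u i) x = kernelConv κ (u i) x - kernelConv κ' (u i) x := by
      rw [kernelConv, kernelConv, kernelConv, ← integral_sub h1 h2]
      rfl
    simp only [Pi.sub_apply, Pi.add_apply, h3]
    abel
  have hfst : eLpNorm (u i - kernelConv κ (u i)) p volume ≤ a := by
    rw [eLpNorm_le_iff_lintegral_rpow_le hp hpt]
    refine (hκ (u i) (hum i) huloc).trans ?_
    refine le_trans ?_ (ENNReal.mul_div_le (a := C₀))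
    gcongr
    exact hδs i
  have hsnd : eLpNorm (kernelConv (κ - κ') (u i)) p volume ≤ a := by
    refine (eLpNorm_kernelConv_le hp hpt (hκm.sub hκ'm) (hum i)).trans ?_
    refine le_trans ?_ (ENNReal.mul_div_le (a := C))
    rw [mul_comm]
    gcongr
    · exact huC i
    · exact hκκ'
  rw [hsplit]
  refine (eLpNorm_add_le ?_ ?_ hp).trans ((add_le_add hfst hsnd).trans ?_)
  · exact (hu i).1.sub (stronglyMeasurable_kernelConv hκm (hum i)).aestronglyMeasurable
  · exact (stronglyMeasurable_kernelConv (hκm.sub hκ'm) (hum i)).aestronglyMeasurable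
  · rw [ha, ← ENNReal.ofReal_add (by positivity) (by positivity), add_halves]

/-- A compactness criterion in `L^p` in terms of directional increments. -/
theorem totallyBounded_range_toLp_restrict_of_projIncr {ι : Type*} {u : ι → E → E} {p : ℝ≥0∞}
    [hp : Fact (1 ≤ p)] (hpt : p ≠ ∞) (hu : ∀ i, MemLp (u i) p volume) {u' : ι → E → E}
    (hum : ∀ i, Measurable (u' i)) (huu' : ∀ i, u i =ᵐ[volume] u' i) {C : ℝ≥0∞}
    (hC : C ≠ ∞) (huC : ∀ i, eLpNorm (u i) p volume ≤ C) {A : Set E} (hA : MeasurableSet A)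
    (hA0 : volume A ≠ 0) {R : ℝ} (hAR : A ⊆ Metric.closedBall 0 R)
    (hsmall : ∀ ε : ℝ≥0∞, ε ≠ 0 → ∃ δ : ℝ, 0 < δ ∧
      ∀ i, ∫⁻ z in A, projIncr p.toReal (u' i) (δ • z) ≤ ε)
    {D : Set E} (hD : MeasurableSet D) (hDb : Bornology.IsBounded D) :
    TotallyBounded (range fun i =>
      (((hu i).restrict D).toLp (u i) : Lp E p (volume.restrict D))) := by
  have hu' : ∀ i, MemLp (u' i) p volume := fun i => (memLp_congr_ae (huu' i)).1 (hu i)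
  have huC' : ∀ i, eLpNorm (u' i) p volume ≤ C := fun i =>
    (eLpNorm_congr_ae (huu' i)).symm.trans_le (huC i)
  have huloc : ∀ i, LocallyIntegrable (u' i) volume := fun i => (hu' i).locallyIntegrable hp.out
  have hL := exists_setIntegral_norm_le hp.out hu' hC huC'
  obtain ⟨R₀, hR₀⟩ := hDb.subset_closedBall 0
  have hDfin : IsFiniteMeasure ((volume : Measure E).restrict D) :=
    ⟨by rw [Measure.restrict_apply_univ]; exact hDb.measure_lt_top⟩
  refine totallyBounded_range_toLp
    (hDb.isCompact_closure.totallyBounded.subset subset_closure) (ae_restrict_mem hD)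
    (fun i => (hu i).restrict D) fun ε hε => ?_
  obtain ⟨κ, hκ, hκc, hκε⟩ :=
    exists_continuous_kernel_approx hp.out hpt hum hu' hC huC' hA hA0 hAR hsmall hε
  refine ⟨fun i => kernelConv κ (u' i),
    fun i => (stronglyMeasurable_kernelConv hκ.stronglyMeasurable (hum i)).aestronglyMeasurable,
    fun i => ?_, ?_, fun η hη => ?_⟩
  · refine (eLpNorm_mono_measure _ Measure.restrict_le_self).trans ?_
    rw [eLpNorm_congr_ae ((huu' i).sub (ae_eq_refl (kernelConv κ (u' i))))]
    exact hκε i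
  · obtain ⟨M, hM⟩ := exists_norm_kernelConv_le hκ hκc huloc hL R₀
    exact ⟨M, fun i x hx => hM i x (hR₀ hx)⟩
  · obtain ⟨r, hr, h⟩ := exists_dist_kernelConv_le hκ hκc hum huloc hL R₀ hη
    exact ⟨r, hr, fun i x hx y hy => h i x (hR₀ hx) y (hR₀ hy)⟩

end Compactness

/-! ### The cone condition and the conclusion. -/

/-- Under the cone condition, the directional increments of a bounded sequence over small
dilations of a conical annulus are uniformly small. -/
theorem exists_lintegral_projIncr_le_of_coneCondition {n : ℕ} {p : ℝ} (hp : 1 ≤ p)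
    {ρ : EuclideanSpace ℝ (Fin (n + 1)) → ℝ} (hρ : Integrable ρ volume)
    (hcone : ConeCondition ρ p) :
    ∃ A : Set (EuclideanSpace ℝ (Fin (n + 1))), MeasurableSet A ∧ volume A ≠ 0 ∧
      A ⊆ Metric.closedBall 0 1 ∧ ∀ S : ℝ≥0∞, S ≠ ∞ → ∀ ε : ℝ≥0∞, ε ≠ 0 → ∃ δ : ℝ, 0 < δ ∧
        ∀ u u' : EuclideanSpace ℝ (Fin (n + 1)) → EuclideanSpace ℝ (Fin (n + 1)),
          Measurable u' → u =ᵐ[volume] u' → seminormPow ρ p u ≤ S →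
            ∫⁻ z in A, projIncr p u' (δ • z) ≤ ε := by
  obtain ⟨θ₀, ⟨hθ0, hθ1⟩, Λ, hΛ, v₀, hv₀, hΛpos, hΛr, hlim⟩ := hcone
  -- Any `η ∈ (0, 1 - θ₀)` would do: the annulus between radii `θ₀` and `1 - η` must be nonempty.
  set η : ℝ := (1 - θ₀) / 2 with hηdef
  have hη : 0 < η := by linarith
  have hθη : θ₀ < 1 - η := by linarith
  set w : EuclideanSpace ℝ (Fin (n + 1)) → ℝ≥0∞ := fun x =>
    ENNReal.ofReal (hρ.1.mk ρ x) with hw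
  have hwm : Measurable w := hρ.1.stronglyMeasurable_mk.measurable.ennreal_ofReal
  have hρw : (fun x => ENNReal.ofReal (ρ x)) =ᵐ[volume] w := by
    filter_upwards [hρ.1.ae_eq_mk] with x hx
    rw [hw, hx]
  set Λ' : Set (Metric.sphere (0 : EuclideanSpace ℝ (Fin (n + 1))) 1) := Subtype.val ⁻¹' Λ with hΛ'
  have hΛ'0 : (volume : Measure (EuclideanSpace ℝ (Fin (n + 1)))).toSphere Λ' ≠ 0 := by
    intro h
    have h1 := hausdorffMeasure_image_eq_zero_of_toSphere h
    rw [hΛ', Subtype.image_preimage_val, inter_eq_right.2 hΛ] at h1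
    rw [Nat.cast_add, Nat.cast_one, add_sub_cancel_right] at hΛpos
    exact hΛpos.ne' h1
  set g : ℝ → ℝ≥0∞ := fun r => lowerEnvelope ρ p θ₀ (r • v₀) with hgdef
  obtain ⟨T, hTm, hT0, hT⟩ := exists_coneAnnulus_lintegral_projIncr_le hp hθ0 hη hθη.le (g := g)
    hwm ((preciseRep_ae_eq hρ).trans hρw) hΛ'0 (by
      intro v hv r hr θ hθ
      exact (hΛr v hv r hr).symm.trans_le (iInf₂_le θ hθ))
  refine ⟨coneAnnulus T θ₀ (1 - η), measurableSet_coneAnnulus hTm _ _,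
    volume_coneAnnulus_pos hTm hT0 hθ0.le hθη, fun z hz => ?_, fun S hS ε hε => ?_⟩
  · rw [mem_closedBall_zero_iff]
    linarith [hz.1.2]
  simp only [finrank_euclideanSpace, Fintype.card_fin, Nat.add_sub_cancel] at hT hlim
  set m : ℝ → ℝ≥0∞ := fun t => ∫⁻ r in Ioo 0 t, g r * ENNReal.ofReal (r ^ n) with hm
  set K := ENNReal.ofReal (θ₀⁻¹ ^ (n + 1)) * ENNReal.ofReal (η⁻¹ ^ p) * S with hK
  have hKtop : K ≠ ∞ :=
    ENNReal.mul_ne_top (ENNReal.mul_ne_top ENNReal.ofReal_ne_top ENNReal.ofReal_ne_top) hS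
  have hlim' : Tendsto (fun t : ℝ => K * (ENNReal.ofReal (t ^ p) / m t)) (𝓝[>] 0) (𝓝 0) := by
    have := ENNReal.Tendsto.const_mul hlim (Or.inr hKtop)
    rwa [mul_zero] at this
  -- Finiteness of the quotient excludes `m t = 0`; `m t = ∞` is harmless.
  obtain ⟨t, ⟨htK, htm⟩, ht0⟩ := (((hlim'.eventually_le_const (pos_iff_ne_zero.2 hε)).and
    (hlim.eventually_lt_const ENNReal.zero_lt_top)).and self_mem_nhdsWithin).exists
  have ht0 : 0 < t := ht0
  have hmt : m t ≠ 0 := by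
    intro h
    have htp : ENNReal.ofReal (t ^ p) ≠ 0 := (ENNReal.ofReal_pos.2 (by positivity)).ne'
    change ENNReal.ofReal (t ^ p) / m t < ∞ at htm
    rw [h, ENNReal.div_zero htp] at htm
    exact htm.ne rfl
  -- With `δ = η⁻¹ t` the radial integral runs up to `ηδ = t`.
  refine ⟨η⁻¹ * t, by positivity, fun u u' hu' huu' huS => ?_⟩
  have h1 := hT u' hu' (η⁻¹ * t) (by positivity)
  rw [mul_inv_cancel_left₀ hη.ne', ← seminormPow_eq_lintegral_projIncr (by linarith) hwm hρw hu'
    huu'] at h1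
  have h2 : (∫⁻ z in coneAnnulus T θ₀ (1 - η), projIncr p u' ((η⁻¹ * t) • z)) * m t ≤
      K * ENNReal.ofReal (t ^ p) := by
    rw [mul_comm]
    refine h1.trans ?_
    rw [Real.mul_rpow (by positivity) ht0.le, ENNReal.ofReal_mul (by positivity), hK]
    calc _ ≤ ENNReal.ofReal (θ₀⁻¹ ^ (n + 1)) *
          (ENNReal.ofReal (η⁻¹ ^ p) * ENNReal.ofReal (t ^ p)) * S := by gcongr
      _ = _ := by ring
  refine le_trans ?_ htK
  rw [← mul_div_assoc]
  exact (ENNReal.le_div_iff_mul_le (Or.inl hmt)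
    (Or.inr (ENNReal.mul_ne_top hKtop ENNReal.ofReal_ne_top))).2 h2

end NonlocalSpace

theorem theorem1p2 {d : ℕ} (p : ℝ≥0∞) [Fact (1 ≤ p)] (hp : p ≠ ∞)
    (ρ : EuclideanSpace ℝ (Fin d) → ℝ) (hρ : Integrable ρ volume) (hρ0 : 0 ≤ᵐ[volume] ρ)
    (hcone : NonlocalSpace.ConeCondition ρ p.toReal)
    (u : ℕ → EuclideanSpace ℝ (Fin d) → EuclideanSpace ℝ (Fin d))
    (hu : ∀ n, NonlocalSpace.MemS ρ p (u n))
    (hbdd : ∃ C : ℝ≥0, ∀ n, NonlocalSpace.normS ρ p (u n) ≤ C)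
    (D : Set (EuclideanSpace ℝ (Fin d))) (hD : IsOpen D) (hDb : Bornology.IsBounded D) :
    IsCompact (closure (range fun n : ℕ =>
      (((hu n).1.restrict D).toLp (u n) :
        Lp (EuclideanSpace ℝ (Fin d)) p (volume.restrict D)))) := by
  have hp1 : 1 ≤ p := Fact.out
  have hq1 : 1 ≤ p.toReal := by
    rw [← ENNReal.toReal_one]
    exact ENNReal.toReal_mono hp hp1
  have hq0 : 0 < p.toReal := by linarith
  obtain ⟨C, hC⟩ := hbdd
  have hsum : ∀ n, eLpNorm (u n) p volume ^ p.toReal + NonlocalSpace.seminormPow ρ p.toReal (u n) ≤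
      (C : ℝ≥0∞) ^ p.toReal := by
    intro n
    have := hC n
    rwa [NonlocalSpace.normS, one_div, ENNReal.rpow_inv_le_iff hq0] at this
  have hLp : ∀ n, eLpNorm (u n) p volume ≤ C := fun n =>
    (ENNReal.rpow_le_rpow_iff hq0).1 (le_self_add.trans (hsum n))
  refine TotallyBounded.isCompact_of_isClosed (TotallyBounded.closure ?_) isClosed_closure
  cases d with
  -- In dimension zero the unit sphere is empty, which contradicts `v₀ ∈ Λ`.
  | zero =>
    obtain ⟨θ₀, -, Λ, hΛ, v₀, hv₀, -⟩ := hcone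
    have h1 := hΛ hv₀
    rw [mem_sphere_zero_iff_norm, Subsingleton.elim v₀ 0, norm_zero] at h1
    exact absurd h1 zero_ne_one
  | succ d =>
    obtain ⟨A, hA, hA0, hA1, hsmall⟩ :=
      NonlocalSpace.exists_lintegral_projIncr_le_of_coneCondition hq1 hρ hcone
    have hm := fun n => (hu n).1.1
    refine NonlocalSpace.totallyBounded_range_toLp_restrict_of_projIncr hp (fun n => (hu n).1)
      (u' := fun n => (hm n).mk (u n))
      (fun n => (hm n).stronglyMeasurable_mk.measurable) (fun n => (hm n).ae_eq_mk)
      ENNReal.coe_ne_top hLp hA hA0 hA1 (fun ε hε => ?_) hD.measurableSet hDb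
    obtain ⟨δ, hδ, h⟩ := hsmall ((C : ℝ≥0∞) ^ p.toReal)
      (ENNReal.rpow_ne_top_of_nonneg hq0.le ENNReal.coe_ne_top) ε hε
    exact ⟨δ, hδ, fun n => h (u n) _ (hm n).stronglyMeasurable_mk.measurable (hm n).ae_eq_mk
      (le_add_self.trans (hsum n))⟩
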